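/- All graphs are finite, simple and undirected. For a graph $G$ let $\Delta(G)$ be its maximum degree, $\omega(G)$ the number of vertices of a largest clique, and $\chi(G)$ its chromatic number. For a graph $H$, call $G$ $H$-free if no induced subgraph of $G$ is isomorphic to $H$. Let $P_n$ be the path on $n$ vertices, $K_n$ the complete graph on $n$ vertices, $H\cup H'$ the disjoint union of $H$ and $H'$, and $mK_1$ the graph with $m$ vertices and no edges. Let $G$ be a graph with $\Delta(G)\ge 9$. If $G$ is $(P_4\cup K_1)$-free, then $$\chi(G)\le\max\{\Delta(G)-1,\ \omega(G)\}.$$ In particular, the same inequality holds if $G$ is $(P_3\cup K_1)$-free, if $G$ is $(K_2\cup 2K_1)$-free, and if $G$ is $3K_1$-free. -/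

import Mathlib

/-- `G` is `H`-free: no induced subgraph of `G` is isomorphic to `H`. -/
def IsInducedFree {V W : Type*} (H : SimpleGraph W) (G : SimpleGraph V) : Prop :=
  ¬ H.IsIndContained G

/-- The path `P₄` on four vertices together with an isolated vertex. -/
def graphP4K1 : SimpleGraph (Fin 4 ⊕ Fin 1) :=
  SimpleGraph.sum (SimpleGraph.pathGraph 4) (⊥ : SimpleGraph (Fin 1))

/-- The path `P₃` on three vertices together with an isolated vertex. -/
def graphP3K1 : SimpleGraph (Fin 3 ⊕ Fin 1) :=
  SimpleGraph.sum (SimpleGraph.pathGraph 3) (⊥ : SimpleGraph (Fin 1))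

/-- An edge `K₂` together with two isolated vertices. -/
def graphK2TwoK1 : SimpleGraph (Fin 2 ⊕ Fin 2) :=
  SimpleGraph.sum (⊤ : SimpleGraph (Fin 2)) (⊥ : SimpleGraph (Fin 2))

/-- Three isolated vertices, `3K₁`. -/
def graphThreeK1 : SimpleGraph (Fin 3) := ⊥

/-! Put m = max(Δ - 1, ω). If `G` were not m-colourable, a critical vertex set would be tight
(`TightOn`) with m ≥ 8. Three properties of tight sets in a (P₄ ∪ K₁)-free graph exclude this.

Order: Gallai's theorem (`CriticalOn.exists_isJoinPartition`) and the fact that tight sets are not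
joins (`TightOn.not_completeTo`) give at least 2m + 1 vertices. With independence number at most
two, the complement would then be triangle-free and dense, hence bipartite by Andrásfai's theorem,
and one of the two resulting cliques would be too large (`TightOn.exists_indepOn_three`).

Cliques: a vertex of an m-clique has at most two neighbours outside it. Colour the outside and
extend by Hall's theorem; this fails only if colour classes dominate nearly the whole clique, and
then two vertices of such a class already do. Separating the dangerous pairs beforehand excludes
m-cliques (`TightOn.card_ne_of_isClique`), and also cliques of mostly low-degree vertices for
smaller m (`TightOn.not_isClique_of_low`).

Peeling: if a largest independent set has three or more vertices, delete it and pass to a critical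
subset. This is a clique or again tight, with m lowered by one, and it gains a layer of low-degree
vertices that meets every induced three-vertex path (`Peel.layered`). Three layers are contradictory
(`Layered.false`); going back up, cliques of the critical size lift
(`TightOn.exists_isClique_of_peel`) until the original set has an m-clique, which is impossible. So
the independence number is at most two, against the first property. -/

section Development

open Classical Finset

universe u

/-! ### Colourings of vertex sets and critical sets. -/

section Basics

variable {V : Type u}

/-- The set `A` of vertices induces a subgraph that can be coloured with `n` colours. -/
def ColorableOn (G : SimpleGraph V) (A : Finset V) (n : ℕ) : Prop :=
  ∃ f : V → ℕ, (∀ u ∈ A, ∀ v ∈ A, G.Adj u v → f u ≠ f v) ∧ (A.image f).card ≤ n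

/-- No two vertices of `S` are adjacent. -/
def IndepOn (G : SimpleGraph V) (S : Finset V) : Prop :=
  ∀ u ∈ S, ∀ v ∈ S, ¬ G.Adj u v

/-- The neighbours of `v` inside `A`. -/
noncomputable def nbrIn (G : SimpleGraph V) (A : Finset V) (v : V) : Finset V :=
  A.filter (G.Adj v)

/-- `A` is not `n`-colourable, but it becomes so when any vertex is deleted. -/
def CriticalOn (G : SimpleGraph V) (A : Finset V) (n : ℕ) : Prop :=
  ¬ ColorableOn G A n ∧ ∀ v ∈ A, ColorableOn G (A.erase v) n

variable {G : SimpleGraph V} {A B X Y S T : Finset V} {m n a b : ℕ} {u v w x y : V}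

lemma mem_nbrIn : u ∈ nbrIn G A v ↔ u ∈ A ∧ G.Adj v u := by simp [nbrIn]

lemma nbrIn_subset : nbrIn G A v ⊆ A := filter_subset _ _

lemma nbrIn_mono (h : A ⊆ B) : nbrIn G A v ⊆ nbrIn G B v := filter_subset_filter _ h

lemma card_nbrIn_add_card_nbrIn_sdiff (h : A ⊆ B) :
    (nbrIn G A v).card + (nbrIn G (B \ A) v).card = (nbrIn G B v).card := by
  rw [← card_union_of_disjoint]
  · congr 1
    ext x
    simp only [mem_union, mem_nbrIn, mem_sdiff]
    have := @h x
    tauto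
  · rw [disjoint_left]
    intro x
    simp only [mem_nbrIn, mem_sdiff]
    tauto

lemma card_nbrIn_union (h : Disjoint A B) :
    (nbrIn G (A ∪ B) v).card = (nbrIn G A v).card + (nbrIn G B v).card := by
  rw [nbrIn, filter_union]
  exact card_union_of_disjoint (disjoint_filter_filter h)

namespace ColorableOn

lemma mono (h : ColorableOn G B n) (hAB : A ⊆ B) : ColorableOn G A n := by
  obtain ⟨f, hf, hc⟩ := h
  exact ⟨f, fun u hu v hv => hf u (hAB hu) v (hAB hv),
    (card_le_card (image_subset_image hAB)).trans hc⟩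

lemma mono_right (h : ColorableOn G A n) (hmn : n ≤ m) : ColorableOn G A m := by
  obtain ⟨f, hf, hc⟩ := h
  exact ⟨f, hf, hc.trans hmn⟩

lemma anti {G' : SimpleGraph V} (h : ColorableOn G' A n)
    (hle : ∀ u ∈ A, ∀ v ∈ A, G.Adj u v → G'.Adj u v) : ColorableOn G A n := by
  obtain ⟨f, hf, hc⟩ := h
  exact ⟨f, fun u hu v hv huv => hf u hu v hv (hle u hu v hv huv), hc⟩

lemma union (hX : ColorableOn G X a) (hY : ColorableOn G Y b) :
    ColorableOn G (X ∪ Y) (a + b) := by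
  obtain ⟨f, hf, hfc⟩ := hX
  obtain ⟨g, hg, hgc⟩ := hY
  refine ⟨fun v => if v ∈ X then 2 * f v else 2 * g v + 1, ?_, ?_⟩
  · intro u hu v hv huv
    have hu' : u ∉ X → u ∈ Y := fun h => (mem_union.1 hu).resolve_left h
    have hv' : v ∉ X → v ∈ Y := fun h => (mem_union.1 hv).resolve_left h
    by_cases h1 : u ∈ X <;> by_cases h2 : v ∈ X <;> simp only [h1, h2, if_true, if_false]
    · have := hf u h1 v h2 huv
      omega
    · omega
    · omega
    · have := hg u (hu' h1) v (hv' h2) huv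
      omega
  · have hsub : (X ∪ Y).image (fun v => if v ∈ X then 2 * f v else 2 * g v + 1) ⊆
        (X.image f).image (fun c => 2 * c) ∪ (Y.image g).image (fun c => 2 * c + 1) := by
      intro c hc
      obtain ⟨v, hv, rfl⟩ := mem_image.1 hc
      by_cases h : v ∈ X
      · simp only [h, if_true]
        exact mem_union_left _ (mem_image_of_mem _ (mem_image_of_mem _ h))
      · simp only [h, if_false]
        exact mem_union_right _ (mem_image_of_mem (fun c => 2 * c + 1)
          (mem_image_of_mem _ ((mem_union.1 hv).resolve_left h)))
    calc _ ≤ _ := card_le_card hsub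
      _ ≤ _ := card_union_le _ _
      _ ≤ (X.image f).card + (Y.image g).card := add_le_add card_image_le card_image_le
      _ ≤ a + b := add_le_add hfc hgc

lemma of_indepOn (h : IndepOn G S) : ColorableOn G S 1 :=
  ⟨fun _ => 0, fun u hu v hv huv => (h u hu v hv huv).elim,
    (card_le_card (t := {0}) (by intro; simp; tauto)).trans (by simp)⟩

lemma of_card : ColorableOn G X X.card := by
  induction X using Finset.induction_on with
  | empty => exact ⟨fun _ => 0, by simp, by simp⟩
  | insert v X hv ih =>
    rw [card_insert_of_notMem hv, add_comm, insert_eq]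
    refine union (of_indepOn ?_) ih
    intro u hu w hw
    simp only [mem_singleton] at hu hw
    subst hu; subst hw
    exact G.loopless.irrefl _

lemma of_sdiff_indepOn (h : ColorableOn G (A \ S) n) (hS : IndepOn G S) :
    ColorableOn G A (n + 1) :=
  (h.union (of_indepOn hS)).mono (by intro v hv; simp; tauto)

lemma exists_lt (h : ColorableOn G A n) :
    ∃ f : V → ℕ, (∀ u ∈ A, ∀ v ∈ A, G.Adj u v → f u ≠ f v) ∧ ∀ v ∈ A, f v < n := by
  obtain ⟨f, hf, hc⟩ := h
  let e := (A.image f).equivFin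
  refine ⟨fun v => if h : f v ∈ A.image f then (e ⟨f v, h⟩ : ℕ) else 0, ?_, ?_⟩
  · intro u hu v hv huv
    have hu' := mem_image_of_mem f hu
    have hv' := mem_image_of_mem f hv
    simp only [hu', hv', dif_pos]
    intro h
    have := e.injective (Fin.ext h)
    exact hf u hu v hv huv (Subtype.mk.inj this)
  · intro v hv
    have hv' := mem_image_of_mem f hv
    simp only [hv', dif_pos]
    exact (e ⟨f v, hv'⟩).isLt.trans_le hc

lemma of_lt {f : V → ℕ} (hf : ∀ u ∈ A, ∀ v ∈ A, G.Adj u v → f u ≠ f v)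
    (hn : ∀ v ∈ A, f v < n) : ColorableOn G A n :=
  ⟨f, hf, (card_le_card (t := range n) (by
    intro c hc
    obtain ⟨v, hv, rfl⟩ := mem_image.1 hc
    exact mem_range.2 (hn v hv))).trans (by simp)⟩

lemma insert_of_card_lt (h : ColorableOn G B n) (hv : (nbrIn G B v).card < n) :
    ColorableOn G (insert v B) n := by
  by_cases hvB : v ∈ B
  · rwa [insert_eq_of_mem hvB]
  obtain ⟨f, hf, hc⟩ := h.exists_lt
  obtain ⟨c, hcn, hcf⟩ : ∃ c ∈ range n, c ∉ (nbrIn G B v).image f := by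
    apply exists_mem_notMem_of_card_lt_card
    rw [card_range]
    exact card_image_le.trans_lt hv
  have key : ∀ u ∈ B, G.Adj v u → c ≠ f u := fun u hu huv h =>
    hcf (mem_image.2 ⟨u, mem_nbrIn.2 ⟨hu, huv⟩, h.symm⟩)
  have hne : ∀ u ∈ B, u ≠ v := fun u hu h => hvB (h ▸ hu)
  refine of_lt (f := Function.update f v c) ?_ ?_
  · intro u hu w hw huw
    rcases mem_insert.1 hu with hu' | hu' <;> rcases mem_insert.1 hw with hw' | hw'
    · subst hu'; subst hw'; exact (G.loopless.irrefl _ huw).elim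
    · subst hu'
      rw [Function.update_self, Function.update_of_ne (hne w hw')]
      exact key w hw' huw
    · subst hw'
      rw [Function.update_self, Function.update_of_ne (hne u hu')]
      exact (key u hu' huw.symm).symm
    · rw [Function.update_of_ne (hne w hw'), Function.update_of_ne (hne u hu')]
      exact hf u hu' w hw' huw
  · intro u hu
    rcases mem_insert.1 hu with hu' | hu'
    · subst hu'; rw [Function.update_self]; exact mem_range.1 hcn
    · rw [Function.update_of_ne (hne u hu')]; exact hc u hu'

/-- The vertices of `T` are coloured greedily at the end. Their degrees are counted in all of `B`,
so the order is irrelevant. -/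
lemma of_sdiff_of_card_lt (h : ColorableOn G (B \ T) n)
    (hT : ∀ v ∈ T, (nbrIn G B v).card < n) : ColorableOn G B n := by
  induction T using Finset.induction_on with
  | empty => simpa using h
  | insert v T _ ih =>
    refine ih ?_ (fun v hv => hT v (mem_insert_of_mem hv))
    refine (insert_of_card_lt h (v := v) ?_).mono ?_
    · exact (card_le_card (nbrIn_mono sdiff_subset)).trans_lt (hT v (mem_insert_self _ _))
    · intro w hw
      simp only [mem_insert, mem_sdiff] at hw ⊢
      tauto

/-- Two sets without edges between them can share their colours. -/
lemma union_of_not_adj (hX : ColorableOn G X n) (hY : ColorableOn G Y n)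
    (h : ∀ x ∈ X, ∀ y ∈ Y, ¬ G.Adj x y) : ColorableOn G (X ∪ Y) n := by
  obtain ⟨f, hf, hfc⟩ := hX.exists_lt
  obtain ⟨g, hg, hgc⟩ := hY.exists_lt
  refine of_lt (f := fun v => if v ∈ X then f v else g v) ?_ ?_
  · intro u hu v hv huv
    have hu' : u ∉ X → u ∈ Y := fun h => (mem_union.1 hu).resolve_left h
    have hv' : v ∉ X → v ∈ Y := fun h => (mem_union.1 hv).resolve_left h
    by_cases h1 : u ∈ X <;> by_cases h2 : v ∈ X <;> simp only [h1, h2, if_true, if_false]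
    · exact hf u h1 v h2 huv
    · exact (h u h1 v (hv' h2) huv).elim
    · exact (h v h2 u (hu' h1) huv.symm).elim
    · exact hg u (hu' h1) v (hv' h2) huv
  · intro v hv
    by_cases h1 : v ∈ X <;> simp only [h1, if_true, if_false]
    · exact hfc v h1
    · exact hgc v ((mem_union.1 hv).resolve_left h1)

end ColorableOn

lemma card_le_of_isClique_of_colorableOn (hT : G.IsClique (T : Set V)) (h : ColorableOn G T n) :
    T.card ≤ n := by
  obtain ⟨f, hf, hc⟩ := h
  rw [← card_image_of_injOn (s := T) (f := f)]
  · exact hc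
  · intro u hu v hv huv
    by_contra hne
    exact hf u hu v hv (hT hu hv hne) huv

lemma exists_criticalOn (h : ¬ ColorableOn G B n) : ∃ A ⊆ B, CriticalOn G A n := by
  induction B using Finset.strongInduction with
  | H B ih =>
    by_cases hB : ∀ v ∈ B, ColorableOn G (B.erase v) n
    · exact ⟨B, Subset.rfl, h, hB⟩
    · push Not at hB
      obtain ⟨v, hv, hcol⟩ := hB
      obtain ⟨A, hA, hcrit⟩ := ih _ (erase_ssubset hv) hcol
      exact ⟨A, hA.trans (erase_subset _ _), hcrit⟩

namespace CriticalOn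

lemma colorableOn_of_ssubset (h : CriticalOn G A n) (hB : B ⊂ A) : ColorableOn G B n := by
  obtain ⟨v, hv, hvB⟩ := exists_of_ssubset hB
  exact (h.2 v hv).mono fun x hx => mem_erase.2 ⟨fun hxv => hvB (hxv ▸ hx), hB.1 hx⟩

lemma le_card_nbrIn (h : CriticalOn G A n) (hv : v ∈ A) : n ≤ (nbrIn G A v).card := by
  by_contra! hlt
  apply h.1
  have := (h.2 v hv).insert_of_card_lt (v := v)
    ((card_le_card (nbrIn_mono (erase_subset _ _))).trans_lt hlt)
  rwa [insert_erase hv] at this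

lemma nonempty (h : CriticalOn G A n) : A.Nonempty := by
  by_contra! hA
  exact h.1 ⟨fun _ => 0, by simp [hA], by simp [hA]⟩

lemma eq_of_clique (h : CriticalOn G A n) (hT : T ⊆ A) (hc : G.IsClique (T : Set V))
    (hn : n < T.card) : T = A := by
  by_contra hne
  have := card_le_of_isClique_of_colorableOn hc (h.colorableOn_of_ssubset (hT.ssubset_of_ne hne))
  omega

lemma lt_card (h : CriticalOn G A n) : n < A.card := by
  by_contra! hle
  exact h.1 (ColorableOn.of_card.mono_right hle)

lemma colorableOn_succ (h : CriticalOn G A n) : ColorableOn G A (n + 1) := by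
  obtain ⟨v, hv⟩ := h.nonempty
  have h1 := h.2 v hv
  rw [← sdiff_singleton_eq_erase] at h1
  refine h1.of_sdiff_indepOn ?_
  intro u hu w hw
  simp only [mem_singleton] at hu hw
  subst hu; subst hw
  exact G.loopless.irrefl _

/-- In a critical set no vertex is dominated by a non-adjacent one. -/
lemma exists_adj_not_adj (h : CriticalOn G A n) (hu : u ∈ A) (hv : v ∈ A) (huv : u ≠ v)
    (hadj : ¬ G.Adj u v) : ∃ w ∈ A, G.Adj u w ∧ ¬ G.Adj v w := by
  by_contra! hdom
  -- Colour everything but `u`; under domination `u` can reuse the colour of `v`.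
  obtain ⟨f, hf, hc⟩ := (h.2 u hu).exists_lt
  have hvA : v ∈ A.erase u := mem_erase.2 ⟨huv.symm, hv⟩
  have hne : ∀ w ∈ A, w ≠ u → w ∈ A.erase u := fun w hw hwu => mem_erase.2 ⟨hwu, hw⟩
  have key : ∀ w ∈ A, w ≠ u → G.Adj u w → f v ≠ f w := fun w hw hwu huw =>
    hf v hvA w (hne w hw hwu) (hdom w hw huw)
  refine h.1 (ColorableOn.of_lt (f := Function.update f u (f v)) ?_ ?_)
  · intro x hx y hy hxy
    by_cases h1 : x = u <;> by_cases h2 : y = u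
    · subst h1; subst h2; exact (G.loopless.irrefl _ hxy).elim
    · subst h1
      rw [Function.update_self, Function.update_of_ne h2]
      exact key y hy h2 hxy
    · subst h2
      rw [Function.update_self, Function.update_of_ne h1]
      exact (key x hx h1 hxy.symm).symm
    · rw [Function.update_of_ne h1, Function.update_of_ne h2]
      exact hf x (hne x hx h1) y (hne y hy h2) hxy
  · intro x hx
    by_cases h1 : x = u
    · subst h1; rw [Function.update_self]; exact hc v hvA
    · rw [Function.update_of_ne h1]; exact hc x (hne x hx h1)

/-- A critical set is connected. -/
lemma exists_adj_sdiff (h : CriticalOn G A n) (hB : B ⊆ A) (hne : B.Nonempty) (hBA : B ≠ A) :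
    ∃ x ∈ B, ∃ y ∈ A \ B, G.Adj x y := by
  by_contra! hno
  have h1 : ColorableOn G B n := h.colorableOn_of_ssubset (hB.ssubset_of_ne hBA)
  have h2 : ColorableOn G (A \ B) n := h.colorableOn_of_ssubset (sdiff_ssubset hB hne)
  have := h1.union_of_not_adj h2 hno
  rw [union_sdiff_of_subset hB] at this
  exact h.1 this

/-- In a critical set that is not a clique, every vertex lies on an induced path with three
vertices. -/
lemma exists_induced_path (h : CriticalOn G A n) (hA : ¬ G.IsClique (A : Set V)) (hx : x ∈ A) :
    ∃ u ∈ A, ∃ v ∈ A, ∃ w ∈ A, G.Adj u v ∧ G.Adj v w ∧ u ≠ w ∧ ¬ G.Adj u w ∧ (x = u ∨ x = v) := by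
  by_cases hall : ∀ y ∈ A, y ≠ x → G.Adj x y
  · simp only [SimpleGraph.IsClique, Set.Pairwise] at hA
    push Not at hA
    obtain ⟨u, hu, w, hw, huw, hn⟩ := hA
    have hux : u ≠ x := by rintro rfl; exact hn (hall w hw huw.symm)
    have hwx : w ≠ x := by rintro rfl; exact hn (hall u hu huw).symm
    exact ⟨u, hu, x, hx, w, hw, (hall u hu hux).symm, hall w hw hwx, huw, hn, Or.inr rfl⟩
  · push Not at hall
    obtain ⟨z, hz, hzx, hxz⟩ := hall
    -- Connectivity, applied to the closed neighbourhood of `x`, yields a vertex `w` at distance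
    -- two.
    obtain ⟨y, hy, w, hw, hyw⟩ := h.exists_adj_sdiff (B := insert x (nbrIn G A x))
      (insert_subset hx nbrIn_subset) ⟨x, mem_insert_self _ _⟩ (by
        intro heq
        have : z ∈ insert x (nbrIn G A x) := by rw [heq]; exact hz
        rcases mem_insert.1 this with h | h
        · exact hzx h
        · exact hxz (mem_nbrIn.1 h).2)
    simp only [mem_sdiff, mem_insert, mem_nbrIn, not_or, not_and] at hw hy
    rcases hy with rfl | hy
    · exact (hw.2.2 hw.1 hyw).elim
    · exact ⟨x, hx, y, hy.1, w, hw.1, hy.2, hyw, fun h => hw.2.1 h.symm, hw.2.2 hw.1, Or.inl rfl⟩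

lemma card_eq_of_isClique (h : CriticalOn G A n) (hA : G.IsClique (A : Set V)) :
    A.card = n + 1 :=
  le_antisymm (card_le_of_isClique_of_colorableOn hA h.colorableOn_succ) h.lt_card

end CriticalOn

end Basics

/-! ### Joins of critical sets and Gallai's bound on the order. -/

section Gallai

variable {V : Type u} {G : SimpleGraph V} {A B X Y S T : Finset V} {m n a b k : ℕ} {u v w x y : V}

/-- Every vertex of `X` is adjacent to every vertex of `Y`. -/
def CompleteTo (G : SimpleGraph V) (X Y : Finset V) : Prop :=
  ∀ x ∈ X, ∀ y ∈ Y, G.Adj x y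

/-- `A` is critical for `m` colours, has maximum degree at most `m + 1` and clique number at most
`m`. -/
structure TightOn (G : SimpleGraph V) (A : Finset V) (m : ℕ) : Prop where
  critical : CriticalOn G A m
  card_nbrIn_le : ∀ v ∈ A, (nbrIn G A v).card ≤ m + 1
  card_le : ∀ T ⊆ A, G.IsClique (T : Set V) → T.card ≤ m

lemma TightOn.not_isClique (h : TightOn G A m) : ¬ G.IsClique (A : Set V) := fun hc =>
  absurd (h.card_le A Subset.rfl hc) (by have := h.critical.lt_card; omega)

lemma indepOn_singleton : IndepOn G {u} := by
  intro x hx y hy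
  rw [mem_singleton.1 hx, mem_singleton.1 hy]
  exact G.loopless.irrefl _

lemma indepOn_insert (hS : IndepOn G S) (h : ∀ v ∈ S, ¬ G.Adj u v) : IndepOn G (insert u S) := by
  intro x hx y hy
  rcases mem_insert.1 hx with rfl | hx' <;> rcases mem_insert.1 hy with rfl | hy'
  · exact G.loopless.irrefl _
  · exact h y hy'
  · exact fun hxy => h x hx' hxy.symm
  · exact hS x hx' y hy'

lemma indepOn_pair (h : ¬ G.Adj u v) : IndepOn G {u, v} :=
  indepOn_insert indepOn_singleton (by simpa using h)

lemma isClique_insert_of_adj (hT : G.IsClique (T : Set V)) (h : ∀ v ∈ T, G.Adj u v) :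
    G.IsClique (insert u T : Finset V) := by
  rw [coe_insert]
  exact hT.insert fun v hv _ => h v hv

lemma isClique_union_of_completeTo (hX : G.IsClique (X : Set V)) (hY : G.IsClique (Y : Set V))
    (h : CompleteTo G X Y) : G.IsClique (X ∪ Y : Finset V) := by
  intro x hx y hy hxy
  rw [mem_coe, mem_union] at hx hy
  rcases hx with hx | hx <;> rcases hy with hy | hy
  · exact hX hx hy hxy
  · exact h x hx y hy
  · exact (h y hy x hx).symm
  · exact hY hx hy hxy

lemma exists_not_adj_of_not_isClique (h : ¬ G.IsClique (X : Set V)) :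
    ∃ u ∈ X, ∃ v ∈ X, u ≠ v ∧ ¬ G.Adj u v := by
  simp only [SimpleGraph.IsClique, Set.Pairwise] at h
  push Not at h
  exact h

namespace CompleteTo

lemma symm (h : CompleteTo G X Y) : CompleteTo G Y X := fun y hy x hx => (h x hx y hy).symm

lemma disjoint (h : CompleteTo G X Y) : Disjoint X Y :=
  disjoint_left.2 fun x hx hy => G.loopless.irrefl _ (h x hx x hy)

lemma card_nbrIn (h : CompleteTo G X Y) (hx : x ∈ X) : (nbrIn G Y x).card = Y.card := by
  congr 1
  exact filter_true_of_mem fun y hy => h x hx y hy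

end CompleteTo

namespace ColorableOn

/-- Complete pairs of sets use disjoint sets of colours. -/
lemma split (h : ColorableOn G (X ∪ Y) n) (hc : CompleteTo G X Y) :
    ∃ a b, a + b ≤ n ∧ ColorableOn G X a ∧ ColorableOn G Y b := by
  obtain ⟨f, hf, hn⟩ := h
  refine ⟨(X.image f).card, (Y.image f).card, ?_, ⟨f, ?_, le_rfl⟩, ⟨f, ?_, le_rfl⟩⟩
  · rw [← card_union_of_disjoint, ← image_union]
    · exact hn
    · rw [disjoint_left]
      intro c hcx hcy
      obtain ⟨x, hx, rfl⟩ := mem_image.1 hcx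
      obtain ⟨y, hy, hxy⟩ := mem_image.1 hcy
      exact hf x (mem_union_left _ hx) y (mem_union_right _ hy) (hc x hx y hy) hxy.symm
  · exact fun u hu v hv => hf u (mem_union_left _ hu) v (mem_union_left _ hv)
  · exact fun u hu v hv => hf u (mem_union_right _ hu) v (mem_union_right _ hv)

lemma pos (h : ColorableOn G X n) (hX : X.Nonempty) : 0 < n := by
  obtain ⟨f, -, hn⟩ := h
  exact (card_pos.2 (hX.image f)).trans_le hn

lemma exists_least (G : SimpleGraph V) (X : Finset V) :
    ∃ k, ColorableOn G X k ∧ ∀ n, ColorableOn G X n → k ≤ n :=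
  ⟨Nat.find ⟨X.card, of_card⟩, Nat.find_spec ⟨X.card, of_card⟩, fun _ h => Nat.find_min' _ h⟩

/-- Each part of a join may be replaced by a set that needs no more colours. -/
lemma replace {D' : Finset V → Finset V} {Q : Finset (Finset V)}
    (h : ColorableOn G (X ∪ Q.biUnion id) n)
    (hX : ∀ D ∈ Q, CompleteTo G D X) (hQ : ∀ D ∈ Q, ∀ E ∈ Q, D ≠ E → CompleteTo G D E)
    (hD : ∀ D ∈ Q, ∀ a, ColorableOn G D a → ColorableOn G (D' D) a) :
    ColorableOn G (X ∪ Q.biUnion D') n := by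
  induction Q using Finset.induction_on generalizing n with
  | empty => simpa using h
  | insert D Q hDQ ih =>
    have h' : ColorableOn G (D ∪ (X ∪ Q.biUnion id)) n := h.mono (by
      intro x
      simp only [biUnion_insert, mem_union, id]
      tauto)
    obtain ⟨a, b, hab, ha, hb⟩ := h'.split (by
      intro d hd x hx
      rcases mem_union.1 hx with hx | hx
      · exact hX D (mem_insert_self _ _) d hd x hx
      · obtain ⟨E, hE, hxE⟩ := mem_biUnion.1 hx
        exact hQ D (mem_insert_self _ _) E (mem_insert_of_mem hE)
          (fun h => hDQ (h ▸ hE)) d hd x hxE)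
    have hb' := ih hb (fun D hD => hX D (mem_insert_of_mem hD))
      (fun D hD E hE => hQ D (mem_insert_of_mem hD) E (mem_insert_of_mem hE))
      (fun D hD' => hD D (mem_insert_of_mem hD'))
    refine (((hD D (mem_insert_self _ _) a ha).union hb').mono_right hab).mono ?_
    intro x
    simp only [biUnion_insert, mem_union]
    tauto

end ColorableOn

lemma exists_injOn_of_card_le_card_biUnion {α β : Type*} [Nonempty β] [DecidableEq β]
    (U : Finset α)
    (t : α → Finset β) (h : ∀ S ⊆ U, S.card ≤ (S.biUnion t).card) :
    ∃ g : α → β, Set.InjOn g U ∧ ∀ u ∈ U, g u ∈ t u := by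
  obtain ⟨g, hg, hgt⟩ := (all_card_le_biUnion_card_iff_exists_injective
    (fun x : U => t x)).1 (by
      intro s
      have := h (s.map (Function.Embedding.subtype _)) (by
        intro x hx
        obtain ⟨y, -, rfl⟩ := mem_map.1 hx
        exact y.2)
      rw [card_map] at this
      refine this.trans (card_le_card ?_)
      intro c
      simp only [mem_biUnion, mem_map]
      rintro ⟨_, ⟨y, hy, rfl⟩, hc⟩
      exact ⟨y, hy, hc⟩)
  refine ⟨fun x => if hx : x ∈ U then g ⟨x, hx⟩ else Classical.arbitrary β, ?_, ?_⟩
  · intro x hx y hy hxy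
    rw [mem_coe] at hx hy
    simp only [hx, hy, dif_pos] at hxy
    exact Subtype.mk.inj (hg hxy)
  · intro u hu
    simp only [hu, dif_pos]
    exact hgt ⟨u, hu⟩

/-- A set that needs almost as many colours as it has vertices contains a large clique. -/
lemma exists_isClique_of_not_colorableOn (h : ¬ ColorableOn G X n) (hX : X.card ≤ n + 2) :
    ∃ T ⊆ X, G.IsClique (T : Set V) ∧ n + 1 ≤ T.card := by
  by_contra! hno
  have hcard : n + 1 ≤ X.card := by
    by_contra! hlt
    exact h (ColorableOn.of_card.mono_right (by omega))
  -- A non-edge saves one colour; two disjoint non-edges, or an independent triple, save two, which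
  -- is too much. So the non-edges form a star, and deleting its centre leaves a clique.
  have two : ∀ u ∈ X, ∀ v ∈ X, u ≠ v → ¬ G.Adj u v → X.card = n + 2 := by
    intro u hu v hv huv hadj
    by_contra hne
    have h1 : (X \ {u, v}).card + 2 = X.card := by
      rw [card_sdiff_of_subset (by simp [insert_subset_iff, hu, hv]), card_pair huv]
      have : 1 < X.card := one_lt_card.2 ⟨u, hu, v, hv, huv⟩
      omega
    exact h ((ColorableOn.of_sdiff_indepOn ColorableOn.of_card (indepOn_pair hadj)).mono_right
      (by omega))
  have four : ∀ u ∈ X, ∀ v ∈ X, ∀ p ∈ X, ∀ q ∈ X, u ≠ v → p ≠ q → ¬ G.Adj u v → ¬ G.Adj p q →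
      Disjoint ({u, v} : Finset V) {p, q} → False := by
    intro u hu v hv p hp q hq huv hpq hadj hadj' hdis
    have h1 : ((X \ {p, q}) \ {u, v}).card + 4 = X.card := by
      rw [sdiff_sdiff_left, sup_eq_union, card_sdiff_of_subset, card_union_of_disjoint hdis.symm,
        card_pair huv, card_pair hpq]
      · have : ({p, q} ∪ {u, v} : Finset V).card ≤ X.card :=
          card_le_card (by simp [insert_subset_iff, *])
        rw [card_union_of_disjoint hdis.symm, card_pair huv, card_pair hpq] at this
        omega
      · simp [insert_subset_iff, *]
    exact h (((ColorableOn.of_card.of_sdiff_indepOn (indepOn_pair hadj)).of_sdiff_indepOn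
      (indepOn_pair hadj')).mono_right (by omega))
  have hXc : ¬ G.IsClique (X : Set V) := fun hc => by
    have := hno X Subset.rfl hc
    omega
  obtain ⟨u, hu, v, hv, huv, hadj⟩ := exists_not_adj_of_not_isClique hXc
  have hcard2 := two u hu v hv huv hadj
  have third : ∀ u ∈ X, ∀ v ∈ X, u ≠ v → ¬ G.Adj u v → ∃ q ∈ X, q ≠ u ∧ q ≠ v ∧ ¬ G.Adj v q := by
    intro u hu v hv huv hadj
    have : ¬ G.IsClique ((X.erase u : Finset V) : Set V) := fun hc => by
      have := hno (X.erase u) (erase_subset _ _) hc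
      rw [card_erase_of_mem hu] at this
      omega
    obtain ⟨p, hp, q, hq, hpq, hadj'⟩ := exists_not_adj_of_not_isClique this
    rw [mem_erase] at hp hq
    by_cases h1 : p = v
    · subst h1
      exact ⟨q, hq.2, hq.1, hpq.symm, hadj'⟩
    by_cases h2 : q = v
    · subst h2
      exact ⟨p, hp.2, hp.1, hpq, fun h => hadj' h.symm⟩
    exact (four u hu v hv p hp.2 q hq.2 huv hpq hadj hadj' (by
      simp only [disjoint_insert_left, mem_insert, mem_singleton, disjoint_singleton_left, not_or]
      exact ⟨⟨hp.1.symm, hq.1.symm⟩, Ne.symm h1, Ne.symm h2⟩)).elim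
  obtain ⟨q, hq, hqu, hqv, hvq⟩ := third u hu v hv huv hadj
  obtain ⟨p, hp, hpv, hpu, hup⟩ := third v hv u hu huv.symm fun h => hadj h.symm
  by_cases hpq : p = q
  · subst hpq
    have hind : IndepOn G {u, v, p} := indepOn_insert (indepOn_pair hvq) (by simp [hadj, hup])
    have h1 : (X \ {u, v, p}).card + 3 = X.card := by
      have h3 : ({u, v, p} : Finset V).card = 3 :=
        card_eq_three.2 ⟨u, v, p, huv, hpu.symm, hpv.symm, rfl⟩
      have hs : ({u, v, p} : Finset V) ⊆ X := by simp [insert_subset_iff, *]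
      have := card_le_card hs
      rw [card_sdiff_of_subset hs]
      omega
    exact h ((ColorableOn.of_card.of_sdiff_indepOn hind).mono_right (by omega))
  · exact four u hu p hp v hv q hq hpu.symm hqv.symm hup hvq (by
      simp only [disjoint_insert_left, mem_insert, mem_singleton, disjoint_singleton_left, not_or]
      exact ⟨⟨huv, hqu.symm⟩, hpv, hpq⟩)

/-- A tight set is not a join. -/
lemma TightOn.not_completeTo (h : TightOn G A m) (hXY : X ∪ Y = A) (hX : X.Nonempty)
    (hY : Y.Nonempty) : ¬ CompleteTo G X Y := by
  intro hc
  -- A critical subset of `X` has a vertex with at least k - 1 neighbours in `X`, and this vertex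
  -- sees all of `Y`, so k - 1 + |Y| ≤ m + 1 ≤ k + l. Each side thus exceeds its chromatic number by
  -- at most one vertex and contains a clique of that number.
  have bound : ∀ {X Y : Finset V} {k l : ℕ}, X ∪ Y = A → X.Nonempty → CompleteTo G X Y →
      (∀ n, ColorableOn G X n → k ≤ n) → 0 < k → m + 1 ≤ k + l → Y.card ≤ l + 1 := by
    intro X Y k l hXY hX hc hk hk0 hkl
    obtain ⟨B, hBX, hB⟩ := exists_criticalOn (G := G) (B := X) (n := k - 1) fun hcol => by
      have := hk _ hcol
      omega
    obtain ⟨v, hv⟩ := hB.nonempty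
    have h1 := hB.le_card_nbrIn hv
    have h2 := card_le_card (nbrIn_mono (G := G) (v := v) hBX)
    have h3 := h.card_nbrIn_le v (hXY ▸ mem_union_left _ (hBX hv))
    rw [← hXY, card_nbrIn_union hc.disjoint, hc.card_nbrIn (hBX hv)] at h3
    omega
  obtain ⟨k, hk, hkmin⟩ := ColorableOn.exists_least G X
  obtain ⟨l, hl, hlmin⟩ := ColorableOn.exists_least G Y
  have hk0 := hk.pos hX
  have hl0 := hl.pos hY
  have hkl : m + 1 ≤ k + l := by
    by_contra! hlt
    have := (hk.union hl).mono_right (show k + l ≤ m by omega)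
    rw [hXY] at this
    exact h.critical.1 this
  have hYc := bound hXY hX hc hkmin hk0 hkl
  have hXc := bound ((union_comm _ _).trans hXY) hY hc.symm hlmin hl0 (show m + 1 ≤ l + k by omega)
  obtain ⟨T, hT, hTc, hTk⟩ := exists_isClique_of_not_colorableOn (G := G) (X := X) (n := k - 1)
    (fun hcol => by have := hkmin _ hcol; omega) (by omega)
  obtain ⟨U, hU, hUc, hUl⟩ := exists_isClique_of_not_colorableOn (G := G) (X := Y) (n := l - 1)
    (fun hcol => by have := hlmin _ hcol; omega) (by omega)
  have hTU : CompleteTo G T U := fun x hx y hy => hc x (hT hx) y (hU hy)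
  have := h.card_le (T ∪ U) (hXY ▸ union_subset_union hT hU)
    (isClique_union_of_completeTo hTc hUc hTU)
  rw [card_union_of_disjoint hTU.disjoint] at this
  omega

/-- `P` is a partition of `A` into critical sets, any two of which are completely joined. -/
structure IsJoinPartition (G : SimpleGraph V) (A : Finset V) (P : Finset (Finset V)) : Prop where
  subset : ∀ D ∈ P, D ⊆ A
  critical : ∀ D ∈ P, ∃ k, CriticalOn G D k
  cover : ∀ v ∈ A, ∃ D ∈ P, v ∈ D
  completeTo : ∀ D ∈ P, ∀ E ∈ P, D ≠ E → CompleteTo G D E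

lemma IsJoinPartition.union {P Q : Finset (Finset V)} (hP : IsJoinPartition G X P)
    (hQ : IsJoinPartition G Y Q) (hc : CompleteTo G X Y) :
    IsJoinPartition G (X ∪ Y) (P ∪ Q) ∧ (P ∪ Q).card = P.card + Q.card := by
  refine ⟨⟨?_, ?_, ?_, ?_⟩, card_union_of_disjoint ?_⟩
  · intro D hD
    rcases mem_union.1 hD with hD | hD
    · exact (hP.subset D hD).trans subset_union_left
    · exact (hQ.subset D hD).trans subset_union_right
  · intro D hD
    rcases mem_union.1 hD with hD | hD
    · exact hP.critical D hD
    · exact hQ.critical D hD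
  · intro v hv
    rcases mem_union.1 hv with hv | hv
    · obtain ⟨D, hD, hvD⟩ := hP.cover v hv
      exact ⟨D, mem_union_left _ hD, hvD⟩
    · obtain ⟨D, hD, hvD⟩ := hQ.cover v hv
      exact ⟨D, mem_union_right _ hD, hvD⟩
  · intro D hD E hE hne
    rcases mem_union.1 hD with hD | hD <;> rcases mem_union.1 hE with hE | hE
    · exact hP.completeTo D hD E hE hne
    · exact fun x hx y hy => hc x (hP.subset D hD hx) y (hQ.subset E hE hy)
    · exact fun x hx y hy => (hc y (hP.subset E hE hy) x (hQ.subset D hD hx)).symm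
    · exact hQ.completeTo D hD E hE hne
  · rw [disjoint_left]
    intro D hD hD'
    obtain ⟨k, hk⟩ := hP.critical D hD
    obtain ⟨v, hv⟩ := hk.nonempty
    exact disjoint_left.1 hc.disjoint (hP.subset D hD hv) (hQ.subset D hD' hv)

/-- The two sides of a critical join are critical. -/
lemma CriticalOn.of_completeTo (h : CriticalOn G (X ∪ Y) m) (hX : X.Nonempty) (hY : Y.Nonempty)
    (hc : CompleteTo G X Y) : ∃ k l, CriticalOn G X k ∧ CriticalOn G Y l ∧ m ≤ k + l + 1 := by
  obtain ⟨k, hk, hkmin⟩ := ColorableOn.exists_least G X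
  obtain ⟨l, hl, hlmin⟩ := ColorableOn.exists_least G Y
  have hk0 := hk.pos hX
  have hl0 := hl.pos hY
  have hkl : m < k + l := by
    by_contra! hlt
    exact h.1 ((hk.union hl).mono_right hlt)
  have hdis := hc.disjoint
  refine ⟨k - 1, l - 1, ⟨fun hcol => ?_, fun v hv => ?_⟩, ⟨fun hcol => ?_, fun v hv => ?_⟩, ?_⟩
  · have := hkmin _ hcol
    omega
  · have hvY : v ∉ Y := disjoint_left.1 hdis hv
    have h1 := h.2 v (mem_union_left _ hv)
    rw [erase_union_distrib, erase_eq_of_notMem hvY] at h1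
    obtain ⟨a, b, hab, ha, hb⟩ := h1.split fun x hx => hc x (mem_of_mem_erase hx)
    obtain ⟨a', b', hab', ha', hb'⟩ := h.colorableOn_succ.split hc
    have := hlmin _ hb
    have := hlmin _ hb'
    have := hkmin _ ha'
    exact ha.mono_right (by omega)
  · have := hlmin _ hcol
    omega
  · have hvX : v ∉ X := disjoint_right.1 hdis hv
    have h1 := h.2 v (mem_union_right _ hv)
    rw [erase_union_distrib, erase_eq_of_notMem hvX] at h1
    obtain ⟨a, b, hab, ha, hb⟩ := h1.split fun x hx y hy => hc x hx y (mem_of_mem_erase hy)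
    obtain ⟨a', b', hab', ha', hb'⟩ := h.colorableOn_succ.split hc
    have := hkmin _ ha
    have := hlmin _ hb'
    have := hkmin _ ha'
    exact hb.mono_right (by omega)
  · omega

/-- If `B` is a critical subset of `A` that has a join partition with at least `|A \ B|` parts, and
`A` is not a join, then `A` is not critical. -/
lemma CriticalOn.card_lt_of_isJoinPartition {P : Finset (Finset V)} (h : CriticalOn G A m)
    (hco : ∀ X Y, X ∪ Y = A → X.Nonempty → Y.Nonempty → ¬ CompleteTo G X Y)
    (hP : IsJoinPartition G B P) (hBA : B ⊂ A) : P.card < (A \ B).card := by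
  by_contra! hcard
  set U := A \ B with hU
  have hUne : U.Nonempty := sdiff_nonempty.2 hBA.2
  let N : V → Finset (Finset V) := fun u => P.filter fun D => ∃ d ∈ D, ¬ G.Adj u d
  have hNP : ∀ S : Finset V, S.biUnion N ⊆ P := fun S =>
    biUnion_subset.2 fun u _ => filter_subset _ _
  have hcomp : ∀ S : Finset V, ∀ D ∈ P, D ∉ S.biUnion N → CompleteTo G D S := by
    intro S D hD hDS d hd s hs
    by_contra hadj
    exact hDS (mem_biUnion.2 ⟨s, hs, mem_filter.2 ⟨hD, d, hd, fun h => hadj h.symm⟩⟩)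
  -- `U'` maximises the deficiency |S| - |N(S)|. It is not all of `U`: with positive deficiency some
  -- part would lie outside `N(U)`, be joined to everything else, and make `A` a join.
  obtain ⟨U', hU', hne, hmax⟩ : ∃ U' ⊆ U, U' ≠ U ∧ ∀ S ⊆ U,
      S.card + (U'.biUnion N).card ≤ U'.card + (S.biUnion N).card := by
    by_cases hall : ∀ S ⊆ U, S.card ≤ (S.biUnion N).card
    · exact ⟨∅, empty_subset _, hUne.ne_empty.symm, fun S hS => by simpa using hall S hS⟩
    · push Not at hall
      obtain ⟨S₀, hS₀, hlt⟩ := hall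
      obtain ⟨U', hU', hmax⟩ := exists_max_image U.powerset
        (fun S => (S.card : ℤ) - (S.biUnion N).card) ⟨S₀, mem_powerset.2 hS₀⟩
      rw [mem_powerset] at hU'
      refine ⟨U', hU', ?_, fun S hS => ?_⟩
      · rintro rfl
        have h0 := hmax S₀ (mem_powerset.2 hS₀)
        obtain ⟨D, hD, hDU⟩ : ∃ D ∈ P, D ∉ U.biUnion N :=
          exists_mem_notMem_of_card_lt_card (by omega)
        obtain ⟨k, hk⟩ := hP.critical D hD
        have hDA : D ⊆ A := (hP.subset D hD).trans hBA.1
        refine hco D (A \ D) (union_sdiff_of_subset hDA) hk.nonempty ?_ ?_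
        · obtain ⟨u, hu⟩ := hUne
          rw [hU, mem_sdiff] at hu
          exact ⟨u, mem_sdiff.2 ⟨hu.1, fun h => hu.2 (hP.subset D hD h)⟩⟩
        · intro d hd x hx
          rw [mem_sdiff] at hx
          by_cases hxB : x ∈ B
          · obtain ⟨E, hE, hxE⟩ := hP.cover x hxB
            exact hP.completeTo D hD E hE (fun h => hx.2 (h ▸ hxE)) d hd x hxE
          · exact hcomp U D hD hDU d hd x (mem_sdiff.2 ⟨hx.1, hxB⟩)
      · have := hmax S (mem_powerset.2 hS)
        omega
  set W := U \ U' with hW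
  have hWne : W.Nonempty := sdiff_nonempty.2 fun hsub => hne (hU'.antisymm hsub)
  let Q := P \ U'.biUnion N
  -- Maximality of `U'` is Hall's condition for matching `W` into the parts outside `N(U')`.
  obtain ⟨g, hginj, hg⟩ := exists_injOn_of_card_le_card_biUnion W (fun u => N u \ U'.biUnion N) (by
    intro S hS
    have h1 := hmax (U' ∪ S) (union_subset hU' (hS.trans sdiff_subset))
    have hdis : Disjoint U' S := disjoint_sdiff.mono_right hS
    have h2 : (U' ∪ S).biUnion N ⊆ U'.biUnion N ∪ S.biUnion fun u => N u \ U'.biUnion N := by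
      intro D
      simp only [mem_biUnion, mem_union, mem_sdiff]
      rintro ⟨u, hu | hu, hD⟩
      · exact Or.inl ⟨u, hu, hD⟩
      · by_cases hD' : ∃ a ∈ U', D ∈ N a
        · exact Or.inl hD'
        · exact Or.inr ⟨u, hu, hD, hD'⟩
    have h3 := (card_le_card h2).trans (card_union_le _ _)
    rw [card_union_of_disjoint hdis] at h1
    omega)
  have hWA : W ⊆ A := sdiff_subset.trans sdiff_subset
  have hcol : ColorableOn G (A \ W) m := h.colorableOn_of_ssubset (sdiff_ssubset hWA hWne)
  have hWB : ∀ x ∈ W, x ∉ B := fun x hx => (mem_sdiff.1 (mem_sdiff.1 hx).1).2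
  let E := U' ∪ (U'.biUnion N).biUnion id
  have hPW : ∀ D ∈ P, ∀ x ∈ D, x ∈ A \ W := fun D hD x hx =>
    mem_sdiff.2 ⟨hBA.1 (hP.subset D hD hx), fun hxW => hWB x hxW (hP.subset D hD hx)⟩
  have hsub : E ∪ Q.biUnion id ⊆ A \ W := by
    intro x hx
    simp only [E, Q, mem_union, mem_biUnion (s := P \ _), mem_biUnion (t := id), id] at hx
    rcases hx with (hx | ⟨D, hD, hx⟩) | ⟨D, hD, hx⟩
    · exact mem_sdiff.2 ⟨(mem_sdiff.1 (hU' hx)).1, fun hxW => (mem_sdiff.1 hxW).2 hx⟩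
    · exact hPW D (hNP _ hD) x hx
    · exact hPW D (mem_sdiff.1 hD).1 x hx
  -- Each part in `Q` absorbs its matched vertex `u` at no cost: a part critical for k already uses
  -- k + 1 colours, and k + 1 suffice with `u` added, since `u` shares a colour with a non-neighbour
  -- `d` and the rest needs only k.
  have hnew := (hcol.mono hsub).replace (D' := fun D => D ∪ W.filter fun u => g u = D) (by
      intro D hD d hd x hx
      rw [mem_sdiff] at hD
      rcases mem_union.1 hx with hx | hx
      · exact hcomp U' D hD.1 hD.2 d hd x hx
      · obtain ⟨F, hF, hxF⟩ := mem_biUnion.1 hx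
        exact hP.completeTo D hD.1 F (hNP _ hF) (fun h => hD.2 (h ▸ hF)) d hd x hxF)
    (fun D hD F hF => hP.completeTo D (mem_sdiff.1 hD).1 F (mem_sdiff.1 hF).1) (by
      intro D hD a ha
      by_cases hu : ∃ u ∈ W, g u = D
      · obtain ⟨u, hu, rfl⟩ := hu
        obtain ⟨k, hk⟩ := hP.critical _ (mem_sdiff.1 hD).1
        have hka : k + 1 ≤ a := by
          by_contra! hlt
          exact hk.1 (ha.mono_right (by omega))
        obtain ⟨hgP, d, hd, hud⟩ := mem_filter.1 (mem_sdiff.1 (hg u hu)).1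
        refine ColorableOn.mono_right ?_ hka
        refine ((hk.2 d hd).mono ?_).of_sdiff_indepOn (indepOn_pair hud)
        intro x hx
        simp only [mem_sdiff, mem_union, mem_filter, mem_insert, mem_singleton, not_or] at hx
        rcases hx with ⟨hx | hx, hxu, hxd⟩
        · exact mem_erase.2 ⟨hxd, hx⟩
        · exact (hxu (hginj hx.1 hu hx.2)).elim
      · refine ha.mono ?_
        intro x hx
        rcases mem_union.1 hx with hx | hx
        · exact hx
        · exact (hu ⟨x, (mem_filter.1 hx).1, (mem_filter.1 hx).2⟩).elim)
  refine h.1 (hnew.mono ?_)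
  intro x hx
  simp only [E, Q, mem_union, mem_biUnion (s := P \ _), mem_biUnion (t := id), id, mem_filter]
  by_cases hxB : x ∈ B
  · obtain ⟨D, hD, hxD⟩ := hP.cover x hxB
    by_cases hDU : D ∈ U'.biUnion N
    · exact Or.inl (Or.inr ⟨D, hDU, hxD⟩)
    · exact Or.inr ⟨D, mem_sdiff.2 ⟨hD, hDU⟩, Or.inl hxD⟩
  · have hxU : x ∈ U := mem_sdiff.2 ⟨hx, hxB⟩
    by_cases hxU' : x ∈ U'
    · exact Or.inl (Or.inl hxU')
    · have hxW : x ∈ W := mem_sdiff.2 ⟨hxU, hxU'⟩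
      have h1 := mem_sdiff.1 (hg x hxW)
      exact Or.inr ⟨g x, mem_sdiff.2 ⟨(mem_filter.1 h1.1).1, h1.2⟩, Or.inr ⟨hxW, rfl⟩⟩

/-- Gallai's theorem on the order of critical graphs that are not joins. -/
theorem CriticalOn.exists_isJoinPartition (h : CriticalOn G A m) :
    ∃ P, IsJoinPartition G A P ∧ 2 * (m + 1) ≤ A.card + P.card := by
  induction A using Finset.strongInduction generalizing m with
  | H A ih =>
    by_cases hco : ∃ X Y, X ∪ Y = A ∧ X.Nonempty ∧ Y.Nonempty ∧ CompleteTo G X Y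
    · obtain ⟨X, Y, rfl, hX, hY, hc⟩ := hco
      obtain ⟨k, l, hk, hl, hkl⟩ := h.of_completeTo hX hY hc
      have hdis := hc.disjoint
      obtain ⟨P, hP, hPc⟩ := ih X (subset_union_left.ssubset_of_ne (by
        intro heq
        obtain ⟨y, hy⟩ := hY
        exact disjoint_right.1 hdis hy (by rw [heq]; exact mem_union_right _ hy))) hk
      obtain ⟨Q, hQ, hQc⟩ := ih Y (subset_union_right.ssubset_of_ne (by
        intro heq
        obtain ⟨x, hx⟩ := hX
        exact disjoint_left.1 hdis hx (by rw [heq]; exact mem_union_left _ hx))) hl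
      refine ⟨P ∪ Q, (hP.union hQ hc).1, ?_⟩
      rw [(hP.union hQ hc).2, card_union_of_disjoint hdis]
      omega
    · by_cases hcard : 2 * m + 1 ≤ A.card
      · refine ⟨{A}, ⟨by simp, by simpa using ⟨m, h⟩, by simp, by simp⟩, ?_⟩
        rw [card_singleton]
        omega
      -- A non-join with at most 2m vertices cannot occur: induction on a smaller critical `B` gives
      -- 2m ≤ |B| + |P|, while |P| < |A \ B|.
      · have hlt := h.lt_card
        obtain ⟨v, hv⟩ := h.nonempty
        obtain ⟨B, hB, hBc⟩ := exists_criticalOn (G := G) (B := A.erase v) (n := m - 1) (by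
          intro hcol
          rw [← sdiff_singleton_eq_erase] at hcol
          exact h.1 ((hcol.of_sdiff_indepOn indepOn_singleton).mono_right (by omega)))
        have hBA : B ⊂ A := hB.trans_ssubset (erase_ssubset hv)
        obtain ⟨P, hP, hPc⟩ := ih B hBA hBc
        push Not at hco
        have h1 := h.card_lt_of_isJoinPartition hco hP hBA
        rw [card_sdiff_of_subset hBA.1] at h1
        have := card_lt_card hBA
        omega

/-- With at most 2m vertices, Gallai's partition would have at least two parts and exhibit `A` as a
join. -/
lemma TightOn.two_mul_lt_card (h : TightOn G A m) : 2 * m < A.card := by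
  obtain ⟨P, hP, hcard⟩ := h.critical.exists_isJoinPartition
  by_contra! hle
  obtain ⟨D, hD, E, hE, hne⟩ := one_lt_card.1 (show 1 < P.card by omega)
  obtain ⟨k, hk⟩ := hP.critical D hD
  obtain ⟨l, hl⟩ := hP.critical E hE
  refine h.not_completeTo (union_sdiff_of_subset (hP.subset D hD)) hk.nonempty ?_ ?_
  · obtain ⟨e, he⟩ := hl.nonempty
    exact ⟨e, mem_sdiff.2 ⟨hP.subset E hE he,
      disjoint_right.1 (hP.completeTo D hD E hE hne).disjoint he⟩⟩
  · intro d hd x hx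
    rw [mem_sdiff] at hx
    obtain ⟨F, hF, hxF⟩ := hP.cover x hx.1
    exact hP.completeTo D hD F hF (fun h => hx.2 (h ▸ hxF)) d hd x hxF

end Gallai

/-! ### Extending colourings to a clique with m vertices. -/

section MaximumClique

variable {V : Type u} {G : SimpleGraph V} {A B I P X Y S T : Finset V} {m n a b k : ℕ}
  {u v w x y : V}

/-- There is no induced `P₄ ∪ K₁` (the necessary inequalities are automatic). -/
def CoGemFree (G : SimpleGraph V) : Prop :=
  ∀ a b c d e, G.Adj a b → G.Adj b c → G.Adj c d → ¬ G.Adj a c → ¬ G.Adj a d → ¬ G.Adj b d →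
    ¬ G.Adj e a → ¬ G.Adj e b → ¬ G.Adj e c → ¬ G.Adj e d → False

/-- If an independent set dominates a clique, then two of its members do. -/
lemma CoGemFree.exists_pair_cover (hG : CoGemFree G) (hY : IndepOn G Y)
    (hX : G.IsClique (X : Set V)) (hne : X.Nonempty) (h : ∀ x ∈ X, ∃ y ∈ Y, G.Adj y x) :
    ∃ y ∈ Y, ∃ z ∈ Y, ∀ x ∈ X, G.Adj y x ∨ G.Adj z x := by
  obtain ⟨x₀, hx₀⟩ := hne
  obtain ⟨y₀, hy₀, -⟩ := h x₀ hx₀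
  -- Take a pair covering as much of `X` as possible. If `t` covers a missed `p`, maximality gives
  -- `r` seen by `y` alone and `q` seen by `z` alone among `y`, `z`, `t`; then y r q z and `t`
  -- induce P₄ ∪ K₁.
  obtain ⟨⟨y, z⟩, hyz, hmax⟩ := exists_max_image (Y ×ˢ Y)
    (fun p => (X.filter fun x => G.Adj p.1 x ∨ G.Adj p.2 x).card) ⟨(y₀, y₀), by simp [hy₀]⟩
  simp only [mem_product] at hyz
  refine ⟨y, hyz.1, z, hyz.2, ?_⟩
  by_contra! hno
  obtain ⟨p, hp, hyp, hzp⟩ := hno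
  obtain ⟨t, ht, htp⟩ := h p hp
  have priv : ∀ y' z' : V, y' ∈ Y → (y' = y ∨ y' = z) →
      (∀ x, G.Adj y x ∨ G.Adj z x ↔ G.Adj y' x ∨ G.Adj z' x) →
      ∃ q ∈ X, G.Adj z' q ∧ ¬ G.Adj y' q ∧ ¬ G.Adj t q := by
    intro y' z' hy' hyy hiff
    by_contra! hno
    have h1 := hmax (y', t) (mem_product.2 ⟨hy', ht⟩)
    have h2 : (X.filter fun x => G.Adj y x ∨ G.Adj z x) ⊂
        X.filter fun x => G.Adj y' x ∨ G.Adj t x := by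
      refine ⟨fun x hx => ?_, fun hsub => ?_⟩
      · rw [mem_filter] at hx ⊢
        refine ⟨hx.1, ?_⟩
        have := (hiff x).1 hx.2
        have := hno x hx.1
        tauto
      · have := hsub (mem_filter.2 ⟨hp, Or.inr htp⟩)
        rw [mem_filter] at this
        exact this.2.elim hyp hzp
    exact absurd (card_lt_card h2) (by simpa using h1)
  obtain ⟨q, hq, hzq, hyq, htq⟩ := priv y z hyz.1 (Or.inl rfl) fun x => Iff.rfl
  obtain ⟨r, hr, hyr, hzr, htr⟩ := priv z y hyz.2 (Or.inr rfl) fun x => or_comm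
  have hrq : r ≠ q := by
    rintro rfl
    exact hyq hyr
  exact hG y r q z t hyr (hX hr hq hrq) hzq.symm hyq (hY y hyz.1 z hyz.2) (fun h => hzr h.symm)
    (hY t ht y hyz.1) htr htq (hY t ht z hyz.2)

/-- A condition under which a colouring outside a set of size `m` extends to that set. -/
lemma ColorableOn.of_sdiff_of_image {f : V → ℕ} (hIm : I.card = m)
    (hf : ∀ u ∈ A \ I, ∀ v ∈ A \ I, G.Adj u v → f u ≠ f v)
    (hlt : ∀ v ∈ A \ I, f v < m) (h2 : ∀ v ∈ I, (nbrIn G (A \ I) v).card ≤ 2)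
    (h0 : ∀ c, ∃ v ∈ I, c ∉ (nbrIn G (A \ I) v).image f)
    (h1 : ∀ q ∈ I, ∀ c c', c ≠ c' → ∃ v ∈ I, v ≠ q ∧
      (c ∉ (nbrIn G (A \ I) v).image f ∨ c' ∉ (nbrIn G (A \ I) v).image f)) :
    ColorableOn G A m := by
  -- Colours missing from all lists over a nonempty `S` are seen by each vertex of `S`, so there are
  -- at most two. Hall's condition can thus fail only for |S| = m, excluded by `h0`, or |S| = m - 1,
  -- excluded by `h1`.
  obtain ⟨g, hginj, hg⟩ := exists_injOn_of_card_le_card_biUnion I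
    (fun v => range m \ (nbrIn G (A \ I) v).image f) (by
      intro S hS
      by_contra! hcard
      have hSI := card_le_card hS
      set U := S.biUnion fun v => range m \ (nbrIn G (A \ I) v).image f with hU
      have hnot : ∀ c ∈ range m \ U, ∀ v ∈ S, c ∈ (nbrIn G (A \ I) v).image f := by
        intro c hc v hv
        rw [mem_sdiff] at hc
        by_contra hcv
        exact hc.2 (mem_biUnion.2 ⟨v, hv, mem_sdiff.2 ⟨hc.1, hcv⟩⟩)
      have hUm : U ⊆ range m := biUnion_subset.2 fun v _ => sdiff_subset
      have hUc := card_sdiff_add_card_eq_card hUm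
      rw [card_range] at hUc
      by_cases hSeq : S = I
      · obtain ⟨c, hc⟩ := card_pos.1 (show 0 < (range m \ U).card by omega)
        obtain ⟨v, hv, hcv⟩ := h0 c
        exact hcv (hnot c hc v (hSeq ▸ hv))
      · obtain ⟨q, hq, hqS⟩ := exists_of_ssubset (hS.ssubset_of_ne hSeq)
        have hlt := card_lt_card (hS.ssubset_of_ne hSeq)
        obtain ⟨c, hc, c', hc', hne⟩ := one_lt_card.1 (show 1 < (range m \ U).card by omega)
        obtain ⟨v₀, hv₀⟩ := card_pos.1 (show 0 < S.card by omega)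
        have hle : (range m \ U).card ≤ 2 := by
          refine (card_le_card fun c hc => hnot c hc v₀ hv₀).trans ?_
          exact card_image_le.trans (h2 v₀ (hS hv₀))
        have hSe : S = I.erase q := by
          refine eq_of_subset_of_card_le (fun x hx => mem_erase.2 ⟨?_, hS hx⟩) ?_
          · rintro rfl
            exact hqS hx
          · rw [card_erase_of_mem hq]
            omega
        obtain ⟨v, hv, hvq, hcv⟩ := h1 q hq c c' hne
        have hvS : v ∈ S := hSe ▸ mem_erase.2 ⟨hvq, hv⟩
        exact hcv.elim (fun h => h (hnot c hc v hvS)) (fun h => h (hnot c' hc' v hvS)))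
  have hcross : ∀ u ∈ I, ∀ w ∈ A, w ∉ I → G.Adj u w → g u ≠ f w := by
    intro u hu w hw hwI huw heq
    exact (mem_sdiff.1 (hg u hu)).2
      (mem_image.2 ⟨w, mem_nbrIn.2 ⟨mem_sdiff.2 ⟨hw, hwI⟩, huw⟩, heq.symm⟩)
  refine ColorableOn.of_lt (f := fun v => if v ∈ I then g v else f v) ?_ ?_
  · intro u hu w hw huw
    by_cases hu' : u ∈ I <;> by_cases hw' : w ∈ I <;> simp only [hu', hw', if_true, if_false]
    · exact fun h => huw.ne (hginj hu' hw' h)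
    · exact hcross u hu' w hw hw' huw
    · exact (hcross w hw' u hu hu' huw.symm).symm
    · exact hf u (mem_sdiff.2 ⟨hu, hu'⟩) w (mem_sdiff.2 ⟨hw, hw'⟩) huw
  · intro v hv
    by_cases hv' : v ∈ I <;> simp only [hv', if_true, if_false]
    · exact mem_range.1 (mem_sdiff.1 (hg v hv')).1
    · exact hlt v (mem_sdiff.2 ⟨hv, hv'⟩)

/-- A colourable set has a colouring separating the pairs of a relation `R` at vertices of few
neighbours. -/
lemma ColorableOn.exists_separating (h : ColorableOn G X m) (R : V → V → Prop)
    (hR : ∀ y z, R y z → R z y) (Big : V → Prop)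
    (hbig : ∀ y ∈ X, Big y → ∀ Z ⊆ X, (∀ z ∈ Z, R y z) → (nbrIn G X y).card + Z.card < m) :
    ∃ f : V → ℕ, (∀ u ∈ X, ∀ v ∈ X, G.Adj u v → f u ≠ f v) ∧ (∀ v ∈ X, f v < m) ∧
      ∀ y ∈ X, ∀ z ∈ X, y ≠ z → R y z → Big y ∨ Big z → f y ≠ f z := by
  -- Extra edges join the related pairs with a big end. Big vertices then have degree below m and
  -- are coloured last.
  let G' : SimpleGraph V :=
    { Adj := fun y z => y ≠ z ∧ (G.Adj y z ∨ (R y z ∧ (Big y ∨ Big z)))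
      symm := ⟨fun y z h => ⟨h.1.symm, h.2.imp (fun h => h.symm) fun h => ⟨hR _ _ h.1, h.2.symm⟩⟩⟩
      loopless := ⟨fun y h => h.1 rfl⟩ }
  have h' : ColorableOn G' X m := by
    refine ColorableOn.of_sdiff_of_card_lt (T := X.filter Big)
      ((h.mono sdiff_subset).anti ?_) ?_
    · intro u hu v hv huv
      simp only [mem_sdiff, mem_filter, not_and] at hu hv
      rcases huv.2 with h | ⟨-, h | h⟩
      · exact h
      · exact (hu.2 hu.1 h).elim
      · exact (hv.2 hv.1 h).elim
    · intro y hy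
      rw [mem_filter] at hy
      refine lt_of_le_of_lt ((card_le_card ?_).trans (card_union_le _ _))
        (hbig y hy.1 hy.2 (X.filter (R y)) (filter_subset _ _) fun z hz => (mem_filter.1 hz).2)
      intro z hz
      rw [mem_nbrIn] at hz
      rcases hz.2.2 with h | h
      · exact mem_union_left _ (mem_nbrIn.2 ⟨hz.1, h⟩)
      · exact mem_union_right _ (mem_filter.2 ⟨hz.1, h.1⟩)
  obtain ⟨f, hf, hlt⟩ := h'.exists_lt
  exact ⟨f, fun u hu v hv huv => hf u hu v hv ⟨huv.ne, Or.inl huv⟩, hlt,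
    fun y hy z hz hyz hr hb => hf y hy z hz ⟨hyz, Or.inr ⟨hr, hb⟩⟩⟩

namespace TightOn

lemma card_nbrIn_sdiff_le (h : TightOn G A m) (hIA : I ⊆ A) (hI : G.IsClique (I : Set V))
    (hIm : I.card = m) (hv : v ∈ I) : (nbrIn G (A \ I) v).card ≤ 2 := by
  have h1 := h.card_nbrIn_le v (hIA hv)
  rw [← card_nbrIn_add_card_nbrIn_sdiff hIA] at h1
  have h2 : I.erase v ⊆ nbrIn G I v := fun x hx => by
    rw [mem_erase] at hx
    exact mem_nbrIn.2 ⟨hx.2, hI hv hx.2 hx.1.symm⟩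
  have h3 := card_le_card h2
  rw [card_erase_of_mem hv] at h3
  omega

lemma card_nbrIn_clique_lt (h : TightOn G A m) (hIA : I ⊆ A) (hI : G.IsClique (I : Set V))
    (hIm : I.card = m) (hy : y ∈ A \ I) : (nbrIn G I y).card < m := by
  rw [mem_sdiff] at hy
  by_contra! hle
  have heq : nbrIn G I y = I := eq_of_subset_of_card_le nbrIn_subset (by omega)
  have := h.card_le (insert y I) (insert_subset hy.1 hIA)
    (isClique_insert_of_adj hI fun v hv => (mem_nbrIn.1 (show v ∈ nbrIn G I y by rwa [heq])).2)
  rw [card_insert_of_notMem hy.2] at this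
  omega

/-- The pairs outside a maximum clique that together dominate it can be separated so as to leave
no colour class dominating the clique. -/
lemma exists_notMem_image (h : TightOn G A m) (hG : CoGemFree G) (hIA : I ⊆ A)
    (hI : G.IsClique (I : Set V)) (hIm : I.card = m) (hm : 0 < m) {f : V → ℕ}
    (hf : ∀ u ∈ A \ I, ∀ v ∈ A \ I, G.Adj u v → f u ≠ f v)
    (hsep : ∀ y ∈ A \ I, ∀ z ∈ A \ I, y ≠ z → (∀ v ∈ I, G.Adj y v ∨ G.Adj z v) →
      m ≤ 2 * (nbrIn G I y).card ∨ m ≤ 2 * (nbrIn G I z).card → f y ≠ f z) (c : ℕ) :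
    ∃ v ∈ I, c ∉ (nbrIn G (A \ I) v).image f := by
  by_contra! hall
  obtain ⟨y, hy, z, hz, hyz⟩ := hG.exists_pair_cover (Y := (A \ I).filter fun y => f y = c)
    (X := I) (by
      intro u hu v hv huv
      rw [mem_filter] at hu hv
      exact hf u hu.1 v hv.1 huv (hu.2.trans hv.2.symm)) hI (card_pos.1 (by omega)) (by
      intro x hx
      obtain ⟨y, hy, hyc⟩ := mem_image.1 (hall x hx)
      rw [mem_nbrIn] at hy
      exact ⟨y, mem_filter.2 ⟨hy.1, hyc⟩, hy.2.symm⟩)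
  rw [mem_filter] at hy hz
  have hsub : I ⊆ nbrIn G I y ∪ nbrIn G I z := fun v hv => by
    rw [mem_union, mem_nbrIn, mem_nbrIn]
    exact (hyz v hv).imp (fun h => ⟨hv, h⟩) fun h => ⟨hv, h⟩
  have hc := (card_le_card hsub).trans (card_union_le _ _)
  have hne : y ≠ z := by
    rintro rfl
    rw [union_self] at hsub
    have := card_le_card hsub
    have := h.card_nbrIn_clique_lt hIA hI hIm hy.1
    omega
  exact hsep y hy.1 z hz.1 hne hyz (by omega) (hy.2.trans hz.2.symm)

/-- A tight set has no clique of size `m` almost all of whose vertices have degree `m`. -/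
lemma not_isClique_of_low (h : TightOn G A m) (hG : CoGemFree G) (hIA : I ⊆ A)
    (hI : G.IsClique (I : Set V)) (hIm : I.card = m) (hPI : P ⊆ I) (hP : P.card ≤ 2)
    (hlow : ∀ v ∈ I, v ∉ P → (nbrIn G A v).card = m) (hm : 6 ≤ m ∨ 5 ≤ m ∧ P = ∅) : False := by
  have hone : ∀ v ∈ I, v ∉ P → (nbrIn G (A \ I) v).card ≤ 1 := by
    intro v hv hvP
    have h1 := hlow v hv hvP
    rw [← card_nbrIn_add_card_nbrIn_sdiff hIA] at h1
    have h2 : I.erase v ⊆ nbrIn G I v := fun x hx => by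
      rw [mem_erase] at hx
      exact mem_nbrIn.2 ⟨hx.2, hI hv hx.2 hx.1.symm⟩
    have h3 := card_le_card h2
    rw [card_erase_of_mem hv] at h3
    omega
  have hm5 : 5 ≤ m := by omega
  have hIne : I.Nonempty := card_pos.1 (by omega)
  -- All partners of a big `y` see each `v` in `I` that `y` misses: at most one partner if such a
  -- `v` is low, at most two if all of them lie in `P`. In the second case `y` has at least m - 2
  -- neighbours in `I`, and m ≥ 6 is needed.
  obtain ⟨f, hf, hlt, hsep⟩ := (h.critical.colorableOn_of_ssubset
    (sdiff_ssubset hIA hIne)).exists_separating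
    (fun y z => ∀ v ∈ I, G.Adj y v ∨ G.Adj z v) (fun y z hyz v hv => (hyz v hv).symm)
    (fun y => m ≤ 2 * (nbrIn G I y).card) (by
      intro y hy hbig Z hZA hZ
      have h1 := h.card_nbrIn_le y (mem_sdiff.1 hy).1
      rw [← card_nbrIn_add_card_nbrIn_sdiff hIA] at h1
      have h2 := h.card_nbrIn_clique_lt hIA hI hIm hy
      have hpart : ∀ v ∈ I, v ∉ nbrIn G I y →
          Z.card ≤ (nbrIn G (A \ I) v).card := by
        intro v hv hvy
        refine card_le_card fun z hz => ?_
        refine mem_nbrIn.2 ⟨hZA hz, ?_⟩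
        exact ((hZ z hz v hv).resolve_left fun h => hvy (mem_nbrIn.2 ⟨hv, h⟩)).symm
      by_cases hex : ∃ v ∈ I, v ∉ nbrIn G I y ∧ v ∉ P
      · obtain ⟨v, hv, hvy, hvP⟩ := hex
        have h3 := hpart v hv hvy
        have h4 := hone v hv hvP
        omega
      · push Not at hex
        obtain ⟨v, hv, hvy⟩ := exists_mem_notMem_of_card_lt_card
          (show (nbrIn G I y).card < I.card by omega)
        have h3 := hpart v hv hvy
        have h4 := h.card_nbrIn_sdiff_le hIA hI hIm hv
        have h5 : I ⊆ nbrIn G I y ∪ P := fun x hx => by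
          by_cases hxy : x ∈ nbrIn G I y
          · exact mem_union_left _ hxy
          · exact mem_union_right _ (hex x hx hxy)
        have h6 := (card_le_card h5).trans (card_union_le _ _)
        rcases hm with hm | ⟨-, rfl⟩
        · omega
        · exact absurd (hex v hv hvy) (notMem_empty v))
  refine h.critical.1 (ColorableOn.of_sdiff_of_image hIm hf hlt
    (fun v hv => h.card_nbrIn_sdiff_le hIA hI hIm hv)
    (h.exists_notMem_image hG hIA hI hIm (by omega) hf
      fun y hy z hz hyz hcov hbig => hsep y hy z hz hyz hcov hbig) ?_)
  intro q hq c c' hne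
  -- A low vertex has at most one neighbour outside `I`, so it cannot see two colours.
  obtain ⟨v, hv, hvq⟩ := exists_mem_notMem_of_card_lt_card
    (show (insert q P).card < I.card from (card_insert_le _ _).trans_lt (by omega))
  rw [mem_insert, not_or] at hvq
  refine ⟨v, hv, hvq.1, ?_⟩
  by_contra! hcon
  have := (one_lt_card.2 ⟨c, hcon.1, c', hcon.2, hne⟩).trans_le card_image_le
  have := hone v hv hvq.2
  omega

/-- A tight set has no clique of size `m` if `m ≥ 8`. -/
lemma card_ne_of_isClique (h : TightOn G A m) (hG : CoGemFree G) (hm : 8 ≤ m) (hIA : I ⊆ A)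
    (hI : G.IsClique (I : Set V)) : I.card ≠ m := by
  intro hIm
  have hIne : I.Nonempty := card_pos.1 (by omega)
  have h2 := fun v hv => h.card_nbrIn_sdiff_le hIA hI hIm (v := v) hv
  have hdeg : ∀ y ∈ A \ I, (nbrIn G I y).card + (nbrIn G (A \ I) y).card ≤ m + 1 := by
    intro y hy
    rw [card_nbrIn_add_card_nbrIn_sdiff hIA]
    exact h.card_nbrIn_le y (mem_sdiff.1 hy).1
  have hIlt := fun y hy => h.card_nbrIn_clique_lt hIA hI hIm (y := y) hy
  let full : V → V → Prop := fun y z => ∀ v ∈ I, G.Adj y v ∨ G.Adj z v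
  -- Pairs jointly missing at most one vertex of `I` are separated too, unless a single member
  -- already misses at most one.
  let near : V → V → Prop := fun y z => (nbrIn G I y).card + 2 ≤ m ∧ (nbrIn G I z).card + 2 ≤ m ∧
    (I.filter fun v => ¬ G.Adj y v ∧ ¬ G.Adj z v).card ≤ 1
  obtain ⟨f, hf, hlt, hsep⟩ := (h.critical.colorableOn_of_ssubset
    (sdiff_ssubset hIA hIne)).exists_separating (fun y z => full y z ∨ near y z)
    (fun y z hyz => hyz.imp (fun hyz v hv => (hyz v hv).symm) fun hyz =>
      ⟨hyz.2.1, hyz.1, by simpa only [and_comm] using hyz.2.2⟩)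
    -- The summand 1 ensures that a pair covering only m - 1 vertices of `I` still has a big member.
    (fun y => m ≤ 2 * (nbrIn G I y).card + 1) (by
      intro y hy hbig Z hZA hZ
      have h1 := hdeg y hy
      have h3 := hIlt y hy
      have hr : (I \ nbrIn G I y).card + (nbrIn G I y).card = m := by
        rw [← hIm]
        exact card_sdiff_add_card_eq_card nbrIn_subset
      by_cases hy1 : (nbrIn G I y).card + 2 ≤ m
      -- If `y` misses r + 1 vertices of `I`, each partner sees at least r of them and each of them
      -- has at most two outside neighbours: |Z| r ≤ 2(r + 1). So |Z| is at most 4, 3, 2 for r = 1,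
      -- r = 2, r ≥ 3. As `y` has at most r + 2 outside neighbours, m ≥ 8 suffices.
      · have hcount : Z.card * ((I \ nbrIn G I y).card - 1) ≤ (I \ nbrIn G I y).card * 2 := by
          refine card_mul_le_card_mul (fun z v => G.Adj z v) ?_ ?_
          · intro z hz
            have hz' := hZ z hz
            have h5 : (I.filter fun v => ¬ G.Adj y v ∧ ¬ G.Adj z v).card ≤ 1 := by
              rcases hz' with hz' | hz'
              · rw [filter_false_of_mem]
                · simp
                · intro v hv hn
                  exact (hz' v hv).elim hn.1 hn.2
              · exact hz'.2.2
            have h6 : I \ nbrIn G I y ⊆ bipartiteAbove (fun z v => G.Adj z v) (I \ nbrIn G I y) z ∪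
                I.filter fun v => ¬ G.Adj y v ∧ ¬ G.Adj z v := by
              intro v hv
              simp only [mem_sdiff, mem_nbrIn, not_and] at hv
              simp only [mem_union, mem_bipartiteAbove, mem_sdiff, mem_nbrIn, mem_filter]
              tauto
            have := (card_le_card h6).trans (card_union_le _ _)
            omega
          · intro v hv
            refine (card_le_card ?_).trans (h2 v (mem_sdiff.1 hv).1)
            intro z hz
            rw [mem_bipartiteBelow] at hz
            exact mem_nbrIn.2 ⟨hZA hz.1, hz.2.symm⟩
        obtain ⟨r, hr'⟩ : ∃ r, (I \ nbrIn G I y).card = r + 1 :=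
          ⟨(I \ nbrIn G I y).card - 1, by omega⟩
        rw [hr', Nat.add_sub_cancel] at hcount
        rw [hr'] at hr
        have hr1 : 1 ≤ r := by omega
        by_cases hr2 : r = 1
        · subst hr2
          omega
        by_cases hr3 : r = 2
        · subst hr3
          omega
        have : Z.card < 3 := by
          by_contra! hZ3
          have := Nat.mul_le_mul_right r hZ3
          omega
        omega
      · obtain ⟨v, hv, hvy⟩ := exists_mem_notMem_of_card_lt_card
          (show (nbrIn G I y).card < I.card by omega)
        have h5 : Z ⊆ nbrIn G (A \ I) v := by
          intro z hz
          refine mem_nbrIn.2 ⟨hZA hz, ?_⟩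
          rcases hZ z hz with h | h
          · exact ((h v hv).resolve_left fun h => hvy (mem_nbrIn.2 ⟨hv, h⟩)).symm
          · exact (hy1 h.1).elim
        have := (card_le_card h5).trans (h2 v hv)
        omega)
  have h0 := h.exists_notMem_image hG hIA hI hIm (by omega) hf
    fun y hy z hz hyz hcov hbig => hsep y hy z hz hyz (Or.inl hcov) (by omega)
  by_cases hB : ∀ q ∈ I, ∀ c c', c ≠ c' → ∃ v ∈ I, v ≠ q ∧
      (c ∉ (nbrIn G (A \ I) v).image f ∨ c' ∉ (nbrIn G (A \ I) v).image f)
  · exact h.critical.1 (ColorableOn.of_sdiff_of_image hIm hf hlt h2 h0 hB)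
  push Not at hB
  obtain ⟨q, hq, c, c', hcc, hB⟩ := hB
  have hqc : (I.erase q).card + 1 = m := by rw [card_erase_add_one hq, hIm]
  have hcl : G.IsClique (I.erase q : Finset V) := hI.subset (by simp)
  -- Two distinct vertices of colour `c` covering `I` without `q` were not separated. Hence both
  -- miss `q`, and one of them misses nothing else.
  have key : ∀ c, (∀ v ∈ I, v ≠ q → c ∈ (nbrIn G (A \ I) v).image f) →
      ∃ x ∈ A \ I, f x = c ∧ ∀ v ∈ I, v ≠ q ↔ G.Adj x v := by
    intro c hc
    have fin : ∀ x ∈ A \ I, (∀ v ∈ I, v ≠ q → G.Adj x v) → ∀ v ∈ I, v ≠ q ↔ G.Adj x v := by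
      intro x hx hx' v hv
      refine ⟨hx' v hv, fun hxv hvq => ?_⟩
      have : I ⊆ nbrIn G I x := fun w hw => mem_nbrIn.2 ⟨hw, by
        by_cases hwq : w = q
        · rw [hwq, ← hvq]
          exact hxv
        · exact hx' w hw hwq⟩
      have := card_le_card this
      have := hIlt x hx
      omega
    obtain ⟨y, hy, z, hz, hyz⟩ := hG.exists_pair_cover (Y := (A \ I).filter fun y => f y = c)
      (X := I.erase q) (by
        intro u hu v hv huv
        rw [mem_filter] at hu hv
        exact hf u hu.1 v hv.1 huv (hu.2.trans hv.2.symm)) hcl (card_pos.1 (by omega)) (by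
        intro x hx
        rw [mem_erase] at hx
        obtain ⟨y, hy, hyc⟩ := mem_image.1 (hc x hx.2 hx.1)
        rw [mem_nbrIn] at hy
        exact ⟨y, mem_filter.2 ⟨hy.1, hyc⟩, hy.2.symm⟩)
    rw [mem_filter] at hy hz
    have hyz' : ∀ v ∈ I, v ≠ q → G.Adj y v ∨ G.Adj z v := fun v hv hvq =>
      hyz v (mem_erase.2 ⟨hvq, hv⟩)
    by_cases hne : y = z
    · subst hne
      exact ⟨y, hy.1, hy.2, fin y hy.1 fun v hv hvq => (hyz' v hv hvq).elim id id⟩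
    have hsub : I.erase q ⊆ nbrIn G I y ∪ nbrIn G I z := fun v hv => by
      rw [mem_union, mem_nbrIn, mem_nbrIn]
      exact (hyz v hv).imp (fun h => ⟨mem_of_mem_erase hv, h⟩) fun h => ⟨mem_of_mem_erase hv, h⟩
    have hc1 := (card_le_card hsub).trans (card_union_le _ _)
    have hnR : ¬ (full y z ∨ near y z) := fun hR =>
      hsep y hy.1 z hz.1 hne hR (by omega) (hy.2.trans hz.2.symm)
    rw [not_or] at hnR
    have hq' : ¬ G.Adj y q ∧ ¬ G.Adj z q := by
      rw [← not_or]
      intro hq'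
      refine hnR.1 fun v hv => ?_
      by_cases hvq : v = q
      · rwa [hvq]
      · exact hyz' v hv hvq
    have hmiss : (I.filter fun v => ¬ G.Adj y v ∧ ¬ G.Adj z v).card ≤ 1 := by
      refine (card_le_card (t := {q}) fun v hv => ?_).trans (by simp)
      rw [mem_filter] at hv
      rw [mem_singleton]
      by_contra hvq
      exact (hyz' v hv.1 hvq).elim hv.2.1 hv.2.2
    have fin2 : ∀ y ∈ A \ I, ¬ G.Adj y q → m < (nbrIn G I y).card + 2 →
        ∀ v ∈ I, v ≠ q → G.Adj y v := by
      intro y _ hyq hcard v hv hvq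
      have h5 : nbrIn G I y ⊆ I.erase q := fun w hw => by
        rw [mem_nbrIn] at hw
        refine mem_erase.2 ⟨?_, hw.1⟩
        rintro rfl
        exact hyq hw.2
      have h6 := eq_of_subset_of_card_le h5 (by omega)
      exact (mem_nbrIn.1 (show v ∈ nbrIn G I y from h6 ▸ mem_erase.2 ⟨hvq, hv⟩)).2
    by_cases hy1 : (nbrIn G I y).card + 2 ≤ m
    · refine ⟨z, hz.1, hz.2, fin z hz.1 (fin2 z hz.1 hq'.2 ?_)⟩
      by_contra! hz1
      exact hnR.2 ⟨hy1, hz1, hmiss⟩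
    · exact ⟨y, hy.1, hy.2, fin y hy.1 (fin2 y hy.1 hq'.1 (by omega))⟩
  obtain ⟨x, hx, hxc, hxI⟩ := key c fun v hv hvq => (hB v hv hvq).1
  obtain ⟨z, hz, hzc, hzI⟩ := key c' fun v hv hvq => (hB v hv hvq).2
  have hxz : x ≠ z := by
    rintro rfl
    exact hcc (hxc.symm.trans hzc)
  have hcompl : ∀ x, (∀ v ∈ I, v ≠ q ↔ G.Adj x v) → ∀ v ∈ I.erase q, G.Adj x v := fun x hxI v hv =>
    (hxI v (mem_of_mem_erase hv)).1 (ne_of_mem_erase hv)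
  have hnadj : ¬ G.Adj x z := by
    intro hadj
    have hzn : z ∉ I.erase q := fun h => (mem_sdiff.1 hz).2 (mem_of_mem_erase h)
    have hxn : x ∉ insert z (I.erase q) := by
      rw [mem_insert, not_or]
      exact ⟨hxz, fun h => (mem_sdiff.1 hx).2 (mem_of_mem_erase h)⟩
    have := h.card_le (insert x (insert z (I.erase q)))
      (insert_subset (mem_sdiff.1 hx).1 (insert_subset (mem_sdiff.1 hz).1
        ((erase_subset _ _).trans hIA)))
      (isClique_insert_of_adj (isClique_insert_of_adj hcl (hcompl z hzI)) (by
        intro v hv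
        rcases mem_insert.1 hv with rfl | hv'
        · exact hadj
        · exact hcompl x hxI v hv'))
    rw [card_insert_of_notMem hxn, card_insert_of_notMem hzn] at this
    omega
  have hdeg2 : ∀ x ∈ A \ I, (∀ v ∈ I, v ≠ q ↔ G.Adj x v) → (nbrIn G (A \ I) x).card ≤ 2 := by
    intro x hx hxI
    have h5 : I.erase q ⊆ nbrIn G I x := fun v hv =>
      mem_nbrIn.2 ⟨mem_of_mem_erase hv, hcompl x hxI v hv⟩
    have := card_le_card h5
    have := hdeg x hx
    omega
  -- `x`, `z` and `q` have at most six outside neighbours in total, so some colour γ avoids them.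
  -- After recolouring `x` and `z` with γ, the vertices of `I` other than `q` see only γ, and `q`
  -- does not see it.
  obtain ⟨γ, hγ, hγn⟩ : ∃ γ ∈ range m, γ ∉ (nbrIn G (A \ I) x ∪ nbrIn G (A \ I) z ∪
      nbrIn G (A \ I) q).image f := by
    apply exists_mem_notMem_of_card_lt_card
    rw [card_range]
    refine card_image_le.trans_lt (((card_union_le _ _).trans
      (Nat.add_le_add_right (card_union_le _ _) _)).trans_lt ?_)
    have := hdeg2 x hx hxI
    have := hdeg2 z hz hzI
    have := h2 q hq
    omega
  have hγn' : ∀ w ∈ A \ I, G.Adj x w ∨ G.Adj z w ∨ G.Adj q w → γ ≠ f w := by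
    intro w hw hadj heq
    refine hγn (mem_image.2 ⟨w, ?_, heq.symm⟩)
    simp only [mem_union, mem_nbrIn]
    tauto
  let g : V → ℕ := fun w => if w = x ∨ w = z then γ else f w
  have hgx : ∀ w, w = x ∨ w = z → g w = γ := fun w hw => if_pos hw
  have hgn : ∀ w, ¬ (w = x ∨ w = z) → g w = f w := fun w hw => if_neg hw
  have hnb : ∀ v ∈ I, v ≠ q → nbrIn G (A \ I) v = {x, z} := by
    intro v hv hvq
    symm
    apply eq_of_subset_of_card_le
    · intro w hw
      rw [mem_insert, mem_singleton] at hw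
      rcases hw with rfl | rfl
      · exact mem_nbrIn.2 ⟨hx, ((hxI v hv).1 hvq).symm⟩
      · exact mem_nbrIn.2 ⟨hz, ((hzI v hv).1 hvq).symm⟩
    · rw [card_pair hxz]
      exact h2 v hv
  have himg : ∀ v ∈ I, v ≠ q → ∀ c ∈ (nbrIn G (A \ I) v).image g, c = γ := by
    intro v hv hvq c hc
    rw [hnb v hv hvq] at hc
    obtain ⟨w, hw, rfl⟩ := mem_image.1 hc
    rw [mem_insert, mem_singleton] at hw
    exact hgx w hw
  refine h.critical.1 (ColorableOn.of_sdiff_of_image (f := g) hIm ?_ ?_ h2 ?_ ?_)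
  · intro u hu w hw huw
    by_cases hux : u = x ∨ u = z <;> by_cases hwx : w = x ∨ w = z
    · rcases hux with rfl | rfl <;> rcases hwx with rfl | rfl
      · exact (G.loopless.irrefl _ huw).elim
      · exact (hnadj huw).elim
      · exact (hnadj huw.symm).elim
      · exact (G.loopless.irrefl _ huw).elim
    · rw [hgx u hux, hgn w hwx]
      refine hγn' w hw ?_
      rcases hux with rfl | rfl
      · exact Or.inl huw
      · exact Or.inr (Or.inl huw)
    · rw [hgx w hwx, hgn u hux]
      refine (hγn' u hu ?_).symm
      rcases hwx with rfl | rfl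
      · exact Or.inl huw.symm
      · exact Or.inr (Or.inl huw.symm)
    · rw [hgn u hux, hgn w hwx]
      exact hf u hu w hw huw
  · intro v hv
    by_cases hvx : v = x ∨ v = z
    · rw [hgx v hvx]
      exact mem_range.1 hγ
    · rw [hgn v hvx]
      exact hlt v hv
  · intro d
    by_cases hd : d = γ
    · subst hd
      refine ⟨q, hq, fun hmem => ?_⟩
      obtain ⟨w, hw, hwd⟩ := mem_image.1 hmem
      rw [mem_nbrIn] at hw
      have hwx : ¬ (w = x ∨ w = z) := by
        rintro (rfl | rfl)
        · exact (hxI q hq).2 hw.2.symm rfl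
        · exact (hzI q hq).2 hw.2.symm rfl
      rw [hgn w hwx] at hwd
      exact hγn' w hw.1 (Or.inr (Or.inr hw.2)) hwd.symm
    · obtain ⟨v, hv⟩ := card_pos.1 (show 0 < (I.erase q).card by omega)
      rw [mem_erase] at hv
      exact ⟨v, hv.2, fun hmem => hd (himg v hv.2 hv.1 d hmem)⟩
  · intro q' hq' d d' hdd
    obtain ⟨v, hv⟩ := card_pos.1 (show 0 < ((I.erase q).erase q').card by
      have := pred_card_le_card_erase (s := I.erase q) (a := q')
      omega)
    simp only [mem_erase] at hv
    refine ⟨v, hv.2.2, hv.1, ?_⟩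
    by_contra! hcon
    exact hdd ((himg v hv.2.2 hv.2.1 d hcon.1).trans (himg v hv.2.2 hv.2.1 d' hcon.2).symm)

end TightOn

end MaximumClique

/-! ### Peeling off largest independent sets. -/

section Peeling

variable {V : Type u} {G : SimpleGraph V} {A B I P X Y S T : Finset V} {m n k : ℕ}
  {a b c s u v w x y : V}

/-- `S` is a largest independent subset of `A`. -/
structure IsMaxIndep (G : SimpleGraph V) (A S : Finset V) : Prop where
  subset : S ⊆ A
  indep : IndepOn G S
  card_le : ∀ T ⊆ A, IndepOn G T → T.card ≤ S.card

/-- The vertex `a` is the only neighbour of `v` in `S`. -/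
def IsPrivate (G : SimpleGraph V) (S : Finset V) (a v : V) : Prop :=
  nbrIn G S v = {a}

namespace IsPrivate

lemma mem (h : IsPrivate G S a v) : a ∈ S :=
  nbrIn_subset (h.symm ▸ mem_singleton_self a : a ∈ nbrIn G S v)

lemma adj (h : IsPrivate G S a v) : G.Adj v a :=
  (mem_nbrIn.1 (h.symm ▸ mem_singleton_self a : a ∈ nbrIn G S v)).2

lemma eq_of_adj (h : IsPrivate G S a v) (hb : b ∈ S) (hvb : G.Adj v b) : b = a :=
  mem_singleton.1 (h ▸ mem_nbrIn.2 ⟨hb, hvb⟩)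

lemma not_adj (h : IsPrivate G S a v) (hb : b ∈ S) (hba : b ≠ a) : ¬ G.Adj v b :=
  fun hvb => hba (h.eq_of_adj hb hvb)

lemma intro (ha : a ∈ S) (hva : G.Adj v a) (h : ∀ b ∈ S, G.Adj v b → b = a) :
    IsPrivate G S a v := by
  ext b
  rw [mem_nbrIn, mem_singleton]
  exact ⟨fun hb => h b hb.1 hb.2, fun hb => hb.symm ▸ ⟨ha, hva⟩⟩

lemma eq (h : IsPrivate G S a v) (h' : IsPrivate G S b v) : a = b :=
  h'.eq_of_adj h.mem h.adj

lemma notMem (h : IsPrivate G S a v) (hS : IndepOn G S) : v ∉ S := fun hv =>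
  hS v hv a h.mem h.adj

end IsPrivate

lemma exists_mem_ne_ne (h : 3 ≤ S.card) (a b : V) : ∃ c ∈ S, c ≠ a ∧ c ≠ b := by
  obtain ⟨c, hc, hcn⟩ := exists_mem_notMem_of_card_lt_card
    (show ({a, b} : Finset V).card < S.card from card_le_two.trans_lt h)
  rw [mem_insert, mem_singleton, not_or] at hcn
  exact ⟨c, hc, hcn⟩

namespace CoGemFree

/-- Otherwise a x y b and a third member of `S` induce P₄ ∪ K₁. -/
lemma not_adj_of_isPrivate (hG : CoGemFree G) (hS : IndepOn G S) (h3 : 3 ≤ S.card)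
    (hx : IsPrivate G S a x) (hy : IsPrivate G S b y) (hab : a ≠ b) : ¬ G.Adj x y := by
  intro hxy
  obtain ⟨c, hc, hca, hcb⟩ := exists_mem_ne_ne h3 a b
  exact hG a x y b c hx.adj.symm hxy hy.adj (fun h => hy.not_adj hx.mem hab h.symm)
    (hS a hx.mem b hy.mem) (hx.not_adj hy.mem hab.symm) (hS c hc a hx.mem)
    (fun h => hx.not_adj hc hca h.symm) (fun h => hy.not_adj hc hcb h.symm) (hS c hc b hy.mem)

/-- A vertex with two neighbours `a`, `b` and a non-neighbour in `S` is adjacent to all private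
neighbours of `a`. -/
lemma adj_of_isPrivate (hG : CoGemFree G) (hS : IndepOn G S) (hx : IsPrivate G S a x)
    (hb : b ∈ S) (hc : c ∈ S) (hba : b ≠ a) (hca : c ≠ a) (hua : G.Adj u a) (hub : G.Adj u b)
    (huc : ¬ G.Adj u c) : G.Adj u x := by
  by_contra hux
  exact hG x a u b c hx.adj hua.symm hub (fun h => hux h.symm) (hx.not_adj hb hba)
    (hS a hx.mem b hb) (fun h => hx.not_adj hc hca h.symm) (hS c hc a hx.mem)
    (fun h => huc h.symm) (hS c hc b hb)

end CoGemFree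

namespace IsMaxIndep

lemma nbrIn_nonempty (h : IsMaxIndep G A S) (hv : v ∈ A) (hvS : v ∉ S) :
    (nbrIn G S v).Nonempty := by
  by_contra! hemp
  have := h.card_le (insert v S) (insert_subset hv h.subset)
    (indepOn_insert h.indep fun x hx hvx =>
      notMem_empty x (hemp ▸ mem_nbrIn.2 ⟨hx, hvx⟩))
  rw [card_insert_of_notMem hvS] at this
  omega

/-- Otherwise exchanging `a` for both `x` and `y` would enlarge `S`. -/
lemma adj_of_isPrivate (h : IsMaxIndep G A S) (hx : x ∈ A) (hy : y ∈ A) (hxa : IsPrivate G S a x)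
    (hya : IsPrivate G S a y) (hne : x ≠ y) : G.Adj x y := by
  by_contra hxy
  have hyn : y ∉ S.erase a := fun hm => hya.notMem h.indep (mem_of_mem_erase hm)
  have hxn : x ∉ insert y (S.erase a) := by
    rw [mem_insert, not_or]
    exact ⟨hne, fun hm => hxa.notMem h.indep (mem_of_mem_erase hm)⟩
  have := h.card_le (insert x (insert y (S.erase a)))
    (insert_subset hx (insert_subset hy ((erase_subset _ _).trans h.subset)))
    (indepOn_insert (indepOn_insert (fun u hu v hv =>
      h.indep u (mem_of_mem_erase hu) v (mem_of_mem_erase hv))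
      fun v hv => hya.not_adj (mem_of_mem_erase hv) (ne_of_mem_erase hv)) (by
        intro v hv
        rcases mem_insert.1 hv with rfl | hv'
        · exact hxy
        · exact hxa.not_adj (mem_of_mem_erase hv') (ne_of_mem_erase hv')))
  rw [card_insert_of_notMem hxn, card_insert_of_notMem hyn, card_erase_of_mem hxa.mem] at this
  have := card_pos.2 ⟨a, hxa.mem⟩
  omega

/-- A critical set of vertices that are private to members of `S` is a clique. -/
lemma isClique_of_isPrivate (h : IsMaxIndep G A S) (hG : CoGemFree G) (h3 : 3 ≤ S.card)
    (hB : CriticalOn G B n) (hBA : B ⊆ A) (hp : ∀ v ∈ B, ∃ a, IsPrivate G S a v) :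
    G.IsClique (B : Set V) := by
  by_contra hc
  obtain ⟨x, hx⟩ := hB.nonempty
  obtain ⟨u, hu, v, hv, w, hw, huv, hvw, hne, huw, -⟩ := hB.exists_induced_path hc hx
  obtain ⟨a, ha⟩ := hp u hu
  obtain ⟨b, hb⟩ := hp v hv
  obtain ⟨c, hc⟩ := hp w hw
  have hab : a = b := by
    by_contra hab
    exact hG.not_adj_of_isPrivate h.indep h3 ha hb hab huv
  have hbc : b = c := by
    by_contra hbc
    exact hG.not_adj_of_isPrivate h.indep h3 hb hc hbc hvw
  subst hab
  subst hbc
  exact huw (h.adj_of_isPrivate (hBA hu) (hBA hw) ha hc hne)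

end IsMaxIndep

/-- Deleting a largest independent set `S` from a tight set `A` and passing to a critical subset
`B`. -/
structure Peel (G : SimpleGraph V) (A : Finset V) (m : ℕ) (S B : Finset V) : Prop where
  tight : TightOn G A (m + 1)
  max : IsMaxIndep G A S
  three_le : 3 ≤ S.card
  subset : B ⊆ A \ S
  critical : CriticalOn G B m

lemma TightOn.exists_peel (h : TightOn G A (m + 1)) (hS : IsMaxIndep G A S) (h3 : 3 ≤ S.card) :
    ∃ B, Peel G A m S B := by
  obtain ⟨B, hB, hc⟩ := exists_criticalOn (G := G) (B := A \ S) (n := m) fun hcol =>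
    h.critical.1 (hcol.of_sdiff_indepOn hS.indep)
  exact ⟨B, h, hS, h3, hB, hc⟩

lemma exists_isMaxIndep (G : SimpleGraph V) (A : Finset V) : ∃ S, IsMaxIndep G A S := by
  obtain ⟨S, hS, hmax⟩ := exists_max_image (A.powerset.filter (IndepOn G)) card
    ⟨∅, by simp [IndepOn]⟩
  rw [mem_filter, mem_powerset] at hS
  exact ⟨S, hS.1, hS.2, fun T hT hTi => hmax T (mem_filter.2 ⟨mem_powerset.2 hT, hTi⟩)⟩

namespace Peel

lemma subset_left (p : Peel G A m S B) : B ⊆ A := p.subset.trans sdiff_subset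

lemma notMem (p : Peel G A m S B) (hv : v ∈ B) : v ∉ S := (mem_sdiff.1 (p.subset hv)).2

lemma card_add_card_le (p : Peel G A m S B) :
    (nbrIn G S v).card + (nbrIn G B v).card + (nbrIn G (A \ (S ∪ B)) v).card =
      (nbrIn G A v).card := by
  rw [← card_nbrIn_union (disjoint_right.2 fun v hv => p.notMem hv),
    card_nbrIn_add_card_nbrIn_sdiff (union_subset p.max.subset p.subset_left)]

lemma one_le (p : Peel G A m S B) (hv : v ∈ B) : 1 ≤ (nbrIn G S v).card :=
  card_pos.2 (p.max.nbrIn_nonempty (p.subset_left hv) (p.notMem hv))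

lemma bound (p : Peel G A m S B) (hv : v ∈ B) :
    (nbrIn G S v).card + (nbrIn G B v).card + (nbrIn G (A \ (S ∪ B)) v).card ≤ m + 2 ∧
      m ≤ (nbrIn G B v).card := by
  rw [p.card_add_card_le]
  exact ⟨p.tight.card_nbrIn_le v (p.subset_left hv), p.critical.le_card_nbrIn hv⟩

lemma exists_isPrivate (p : Peel G A m S B) (hv : v ∈ B) (h : (nbrIn G S v).card < 2) :
    ∃ a, IsPrivate G S a v :=
  card_eq_one.1 (by have := p.one_le hv; omega)

/-- A vertex of `B` with two neighbours in `S` has no neighbours outside `S ∪ B`. -/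
lemma mem_of_adj (p : Peel G A m S B) (hv : v ∈ B) (h : 2 ≤ (nbrIn G S v).card) (hw : w ∈ A)
    (hvw : G.Adj v w) (hwS : w ∉ S) : w ∈ B := by
  by_contra hwB
  have := p.bound hv
  have : 0 < (nbrIn G (A \ (S ∪ B)) v).card := card_pos.2
    ⟨w, mem_nbrIn.2 ⟨mem_sdiff.2 ⟨hw, by simp [hwS, hwB]⟩, hvw⟩⟩
  omega

lemma card_nbrIn_eq (p : Peel G A m S B) (hv : v ∈ B) (h : 2 ≤ (nbrIn G S v).card) :
    (nbrIn G B v).card = m := by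
  have := p.bound hv
  omega

lemma card_nbrIn_eq_of_adj (p : Peel G A m S B) (hv : v ∈ B) (hw : w ∈ A) (hvw : G.Adj v w)
    (hwS : w ∉ S) (hwB : w ∉ B) : (nbrIn G B v).card = m := by
  have := p.bound hv
  have := p.one_le hv
  have : 0 < (nbrIn G (A \ (S ∪ B)) v).card := card_pos.2
    ⟨w, mem_nbrIn.2 ⟨mem_sdiff.2 ⟨hw, by simp [hwS, hwB]⟩, hvw⟩⟩
  omega

lemma card_le_one (p : Peel G A m S B) (hv : v ∈ B) (hT : T ⊆ A) (hTS : Disjoint T S)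
    (hTB : Disjoint T B) (hadj : ∀ t ∈ T, G.Adj v t) : T.card ≤ 1 := by
  have := p.bound hv
  have := p.one_le hv
  have : T.card ≤ (nbrIn G (A \ (S ∪ B)) v).card := card_le_card fun t ht => by
    refine mem_nbrIn.2 ⟨mem_sdiff.2 ⟨hT ht, ?_⟩, hadj t ht⟩
    rw [mem_union, not_or]
    exact ⟨disjoint_left.1 hTS ht, disjoint_left.1 hTB ht⟩
  omega

lemma tightOn (p : Peel G A m S B) (hB : ¬ G.IsClique (B : Set V)) : TightOn G B m := by
  refine ⟨p.critical, fun v hv => ?_, fun T hT hTc => ?_⟩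
  · have := p.bound hv
    have := p.one_le hv
    omega
  · by_contra! hlt
    exact hB (p.critical.eq_of_clique hT hTc hlt ▸ hTc)

end Peel

/-- Disjoint sets of vertices of degree `m`, each of which meets all induced paths with three
vertices. -/
structure Layered (G : SimpleGraph V) (A : Finset V) (m i : ℕ) (W : ℕ → Finset V) : Prop where
  low : ∀ l < i, ∀ v ∈ W l, v ∈ A ∧ (nbrIn G A v).card = m
  disjoint : ∀ l < i, ∀ k < i, l ≠ k → Disjoint (W l) (W k)
  meets : ∀ l < i, ∀ u ∈ A, ∀ v ∈ A, ∀ w ∈ A, G.Adj u v → G.Adj v w → u ≠ w → ¬ G.Adj u w →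
    u ∈ W l ∨ v ∈ W l ∨ w ∈ W l

/-- The new layer consists of the vertices with two neighbours in `S`; the budget makes them low. A
vertex low in `A` has exactly one neighbour in `S`, so old layers stay low and avoid the new one.
Private vertices are adjacent exactly when they belong to the same member of `S`, so they carry no
induced three-vertex path. -/
lemma Peel.layered (p : Peel G A m S B) (hG : CoGemFree G) {i : ℕ} {W : ℕ → Finset V}
    (hW : Layered G A (m + 1) i W) : ∃ W', Layered G B m (i + 1) W' := by
  refine ⟨fun l => if l = i then B.filter fun v => 2 ≤ (nbrIn G S v).card else W l ∩ B,
    ?_, ?_, ?_⟩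
  · intro l hl v hv
    by_cases hli : l = i
    · simp only [hli, if_true, mem_filter] at hv
      exact ⟨hv.1, p.card_nbrIn_eq hv.1 hv.2⟩
    · simp only [hli, if_false, mem_inter] at hv
      refine ⟨hv.2, ?_⟩
      have h1 := (hW.low l (by omega) v hv.1).2
      rw [← p.card_add_card_le] at h1
      have := p.one_le hv.2
      have := p.bound hv.2
      omega
  · have key : ∀ l < i, Disjoint (W l ∩ B) (B.filter fun v => 2 ≤ (nbrIn G S v).card) := by
      intro l hl
      rw [disjoint_left]
      intro v hv hv'
      rw [mem_inter] at hv
      rw [mem_filter] at hv'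
      have h1 := (hW.low l hl v hv.1).2
      rw [← p.card_add_card_le] at h1
      have := p.bound hv.2
      omega
    intro l hl k hk hlk
    by_cases hli : l = i <;> by_cases hki : k = i <;> simp only [hli, hki, if_true, if_false]
    · omega
    · exact (key k (by omega)).symm
    · exact key l (by omega)
    · exact (hW.disjoint l (by omega) k (by omega) hlk).mono inter_subset_left inter_subset_left
  · intro l hl u hu v hv w hw huv hvw hne huw
    by_cases hli : l = i
    · simp only [hli, if_true, mem_filter]
      by_contra! hno
      obtain ⟨a, ha⟩ := p.exists_isPrivate hu (hno.1 hu)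
      obtain ⟨b, hb⟩ := p.exists_isPrivate hv (hno.2.1 hv)
      obtain ⟨c, hc⟩ := p.exists_isPrivate hw (hno.2.2 hw)
      have hab : a = b := by
        by_contra hab
        exact hG.not_adj_of_isPrivate p.max.indep p.three_le ha hb hab huv
      have hbc : b = c := by
        by_contra hbc
        exact hG.not_adj_of_isPrivate p.max.indep p.three_le hb hc hbc hvw
      subst hab
      subst hbc
      exact huw (p.max.adj_of_isPrivate (p.subset_left hu) (p.subset_left hw) ha hc hne)
    · simp only [hli, if_false, mem_inter, hu, hv, hw, and_true]
      exact hW.meets l (by omega) u (p.subset_left hu) v (p.subset_left hv) w (p.subset_left hw)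
        huv hvw hne huw

namespace Layered

/-- The path has a vertex in each of the disjoint layers; three layers exhaust it. -/
lemma le_three {i : ℕ} {W : ℕ → Finset V} (hW : Layered G A m i W) (hu : u ∈ A) (hv : v ∈ A)
    (hw : w ∈ A) (huv : G.Adj u v) (hvw : G.Adj v w) (hne : u ≠ w) (huw : ¬ G.Adj u w) :
    i ≤ 3 ∧ (i = 3 → ∀ x ∈ ({u, v, w} : Finset V), (nbrIn G A x).card = m) := by
  have h : ∀ l < i, ∃ x ∈ ({u, v, w} : Finset V), x ∈ W l := by
    intro l hl
    simpa using hW.meets l hl u hu v hv w hw huv hvw hne huw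
  have : Nonempty V := ⟨u⟩
  choose! z hz hzW using h
  have hinj : Set.InjOn z ((range i : Finset ℕ) : Set ℕ) := by
    intro l hl k hk hlk
    rw [mem_coe, mem_range] at hl hk
    by_contra hne
    exact disjoint_left.1 (hW.disjoint l hl k hk hne) (hzW l hl) (hlk ▸ hzW k hk)
  have hsub : (range i).image z ⊆ {u, v, w} := by
    intro x hx
    obtain ⟨l, hl, rfl⟩ := mem_image.1 hx
    exact hz l (mem_range.1 hl)
  have hcard := card_image_of_injOn hinj
  rw [card_range] at hcard
  refine ⟨hcard ▸ (card_le_card hsub).trans card_le_three, ?_⟩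
  rintro rfl x hx
  rw [← eq_of_subset_of_card_le hsub (card_le_three.trans hcard.ge)] at hx
  obtain ⟨l, hl, rfl⟩ := mem_image.1 hx
  exact (hW.low l (mem_range.1 hl) _ (hzW l (mem_range.1 hl))).2

lemma lt_four {i : ℕ} {W : ℕ → Finset V} (hW : Layered G A m i W) (h : TightOn G A m) :
    i ≤ 3 := by
  obtain ⟨x, hx⟩ := h.critical.nonempty
  obtain ⟨u, hu, v, hv, w, hw, huv, hvw, hne, huw, -⟩ :=
    h.critical.exists_induced_path h.not_isClique hx
  exact (hW.le_three hu hv hw huv hvw hne huw).1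

/-- By criticality every vertex lies on an induced three-vertex path, and three layers fill it. -/
lemma card_nbrIn_eq {W : ℕ → Finset V} (hW : Layered G A m 3 W) (h : TightOn G A m) (hx : x ∈ A) :
    (nbrIn G A x).card = m := by
  obtain ⟨u, hu, v, hv, w, hw, huv, hvw, hne, huw, hxuv⟩ :=
    h.critical.exists_induced_path h.not_isClique hx
  refine (hW.le_three hu hv hw huv hvw hne huw).2 rfl x ?_
  rcases hxuv with rfl | rfl <;> simp

lemma exists_low {i : ℕ} {W : ℕ → Finset V} (hW : Layered G A m i W) (h : TightOn G A m)
    (hi : 0 < i) : ∃ x ∈ A, (nbrIn G A x).card = m := by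
  obtain ⟨x, hx⟩ := h.critical.nonempty
  obtain ⟨u, hu, v, hv, w, hw, huv, hvw, hne, huw, -⟩ :=
    h.critical.exists_induced_path h.not_isClique hx
  rcases hW.meets 0 hi u hu v hv w hw huv hvw hne huw with h | h | h
  exacts [⟨u, hW.low 0 hi u h⟩, ⟨v, hW.low 0 hi v h⟩, ⟨w, hW.low 0 hi w h⟩]

end Layered

/-- If the independence number is at most two, then the non-neighbours of a vertex of degree `m`
form a clique of size `m`. -/
lemma TightOn.exists_isClique_of_card_le_two (h : TightOn G A m)
    (hα : ∀ T ⊆ A, IndepOn G T → T.card ≤ 2) (hv : v ∈ A) (hlow : (nbrIn G A v).card = m) :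
    ∃ I ⊆ A, G.IsClique (I : Set V) ∧ I.card = m := by
  have hvn : v ∉ nbrIn G A v := fun h => G.loopless.irrefl _ (mem_nbrIn.1 h).2
  have hsub : insert v (nbrIn G A v) ⊆ A := insert_subset hv nbrIn_subset
  have hcl : G.IsClique (A \ insert v (nbrIn G A v) : Finset V) := by
    intro x hx y hy hxy
    rw [mem_coe, mem_sdiff, mem_insert, mem_nbrIn, not_or, not_and] at hx hy
    by_contra hadj
    have hvy : v ≠ y := fun h => hy.2.1 h.symm
    have hvx : v ≠ x := fun h => hx.2.1 h.symm
    have := hα {v, x, y} (by simp [insert_subset_iff, hv, hx.1, hy.1])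
      (indepOn_insert (indepOn_pair hadj) (by simp [hx.2.2 hx.1, hy.2.2 hy.1]))
    rw [card_eq_three.2 ⟨v, x, y, hvx, hvy, hxy, rfl⟩] at this
    omega
  refine ⟨_, sdiff_subset, hcl, le_antisymm (h.card_le _ sdiff_subset hcl) ?_⟩
  have := h.two_mul_lt_card
  rw [card_sdiff_of_subset hsub, card_insert_of_notMem hvn]
  omega

/-- With all vertices low there is no m-clique. Yet a further peel gives such a clique or a fourth
layer, and if there is nothing to peel, the non-neighbours of any vertex form one. -/
lemma Layered.false {W : ℕ → Finset V} (hW : Layered G A m 3 W) (h : TightOn G A m)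
    (hG : CoGemFree G) (hm : 5 ≤ m) : False := by
  have key : ∀ I ⊆ A, G.IsClique (I : Set V) → I.card ≠ m := fun I hIA hI hIm =>
    h.not_isClique_of_low hG hIA hI hIm (empty_subset I) (by simp)
      (fun v hv _ => hW.card_nbrIn_eq h (hIA hv)) (Or.inr ⟨hm, rfl⟩)
  obtain ⟨S, hS⟩ := exists_isMaxIndep G A
  by_cases h3 : 3 ≤ S.card
  · obtain ⟨m, rfl⟩ : ∃ k, m = k + 1 := ⟨m - 1, by omega⟩
    obtain ⟨B, p⟩ := h.exists_peel hS h3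
    by_cases hB : G.IsClique (B : Set V)
    · exact key B p.subset_left hB (p.critical.card_eq_of_isClique hB)
    · obtain ⟨W', hW'⟩ := p.layered hG hW
      have := hW'.lt_four (p.tightOn hB)
      omega
  · obtain ⟨x, hx⟩ := h.critical.nonempty
    obtain ⟨I, hIA, hI, hIm⟩ := h.exists_isClique_of_card_le_two
      (fun T hT hTi => (hS.card_le T hT hTi).trans (by omega)) hx (hW.card_nbrIn_eq h hx)
    exact key I hIA hI hIm

lemma Layered.exists_isClique_of_two {W : ℕ → Finset V} (hW : Layered G A m 2 W)
    (h : TightOn G A m) (hG : CoGemFree G) (hm : 6 ≤ m) :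
    ∃ I ⊆ A, G.IsClique (I : Set V) ∧ I.card = m := by
  obtain ⟨S, hS⟩ := exists_isMaxIndep G A
  by_cases h3 : 3 ≤ S.card
  · obtain ⟨m, rfl⟩ : ∃ k, m = k + 1 := ⟨m - 1, by omega⟩
    obtain ⟨B, p⟩ := h.exists_peel hS h3
    by_cases hB : G.IsClique (B : Set V)
    · exact ⟨B, p.subset_left, hB, p.critical.card_eq_of_isClique hB⟩
    · obtain ⟨W', hW'⟩ := p.layered hG hW
      exact (hW'.false (p.tightOn hB) hG (by omega)).elim
  · obtain ⟨x, hx, hlow⟩ := hW.exists_low h (by omega)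
    exact h.exists_isClique_of_card_le_two
      (fun T hT hTi => (hS.card_le T hT hTi).trans (by omega)) hx hlow

lemma eq_triple_of_card (h : S.card = 3) (hs : s ∈ S) (hb : b ∈ S) (hc : c ∈ S) (hsb : s ≠ b)
    (hsc : s ≠ c) (hbc : b ≠ c) : S = {s, b, c} := by
  symm
  apply eq_of_subset_of_card_le
  · simp [insert_subset_iff, hs, hb, hc]
  · rw [h, card_eq_three.2 ⟨s, b, c, hsb, hsc, hbc, rfl⟩]

/-- If no clique has size `m + 1`, then no member of a largest independent set with three elements
has a clique of `m - 1` private neighbours. -/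
lemma TightOn.false_of_private_clique (h : TightOn G A (m + 1)) (hG : CoGemFree G)
    (hno : ∀ I ⊆ A, G.IsClique (I : Set V) → I.card ≠ m + 1) (hS : IsMaxIndep G A {s, b, c})
    (hsb : s ≠ b) (hsc : s ≠ c) (hbc : b ≠ c) (hPA : P ⊆ A) (hP : G.IsClique (P : Set V))
    (hPm : P.card + 1 = m) (hm : 2 ≤ m) (hpriv : ∀ p ∈ P, IsPrivate G {s, b, c} s p) : False := by
  have hS3 : ({s, b, c} : Finset V).card = 3 := card_eq_three.2 ⟨s, b, c, hsb, hsc, hbc, rfl⟩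
  have hsS : s ∈ ({s, b, c} : Finset V) := by simp
  have hbS : b ∈ ({s, b, c} : Finset V) := by simp
  have hcS : c ∈ ({s, b, c} : Finset V) := by simp
  obtain ⟨v, hv⟩ := card_pos.1 (show 0 < P.card by omega)
  have hsP : s ∉ P := fun hs => (hpriv s hs).notMem hS.indep hsS
  -- Otherwise `u` sees all of `P` and extends `P` and `s` to a clique on m + 1 vertices.
  have type : ∀ u ∈ A, ∀ d ∈ ({s, b, c} : Finset V), ∀ e ∈ ({s, b, c} : Finset V), d ≠ s → e ≠ s →
      G.Adj u s → G.Adj u d → G.Adj u e := by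
    intro u hu b' hb' c' hc' hbs hcs hus hub
    by_contra huc
    have hadj : ∀ p ∈ P, G.Adj u p := fun p hp =>
      hG.adj_of_isPrivate hS.indep (hpriv p hp) hb' hc' hbs hcs hus hub huc
    have huP : u ∉ P := fun h => G.loopless.irrefl _ (hadj u h)
    have hus' : u ∉ insert s P := by
      rw [mem_insert, not_or]
      exact ⟨hus.ne, huP⟩
    refine hno (insert u (insert s P)) (insert_subset hu (insert_subset (hS.subset hsS) hPA))
      (isClique_insert_of_adj (isClique_insert_of_adj hP fun p hp => (hpriv p hp).adj.symm) ?_) ?_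
    · intro p hp
      rcases mem_insert.1 hp with rfl | hp'
      · exact hus
      · exact hadj p hp'
    · rw [card_insert_of_notMem hus', card_insert_of_notMem hsP]
      omega
  -- As `d` is not dominated by `e`, it has a neighbour missing `e`; by `type` that neighbour misses
  -- `s` as well.
  have priv : ∀ d ∈ ({s, b, c} : Finset V), ∀ e ∈ ({s, b, c} : Finset V), d ≠ s → e ≠ s → d ≠ e →
      ∃ x ∈ A, IsPrivate G {s, b, c} d x := by
    intro b' hb' c' hc' hbs hcs hbc'
    obtain ⟨x, hx, hbx, hcx⟩ := h.critical.exists_adj_not_adj (hS.subset hb') (hS.subset hc') hbc'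
      (hS.indep b' hb' c' hc')
    refine ⟨x, hx, IsPrivate.intro hb' hbx.symm ?_⟩
    intro d hd hxd
    rw [eq_triple_of_card hS3 hsS hb' hc' hbs.symm hcs.symm hbc'] at hd
    simp only [mem_insert, mem_singleton] at hd
    rcases hd with rfl | rfl | rfl
    · exact (hcx (type x hx b' hb' c' hc' hbs hcs hxd hbx.symm).symm).elim
    · rfl
    · exact (hcx hxd.symm).elim
  obtain ⟨x, hx, hxb⟩ := priv b hbS c hcS hsb.symm hsc.symm hbc
  obtain ⟨y, hy, hyc⟩ := priv c hcS b hbS hsc.symm hsb.symm hbc.symm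
  have hvs := hpriv v hv
  have nadj : ∀ {d e p q}, IsPrivate G {s, b, c} d p → IsPrivate G {s, b, c} e q → d ≠ e →
      p ≠ q ∧ ¬ G.Adj p q := fun {d e p q} hp hq hde =>
    ⟨fun h => hde (hp.eq (h ▸ hq)), hG.not_adj_of_isPrivate hS.indep hS3.ge hp hq hde⟩
  have hvx := nadj hvs hxb hsb
  have hvy := nadj hvs hyc hsc
  have hxy := nadj hxb hyc hbc
  have hT3 : ({v, x, y} : Finset V).card = 3 := card_eq_three.2 ⟨v, x, y, hvx.1, hvy.1, hxy.1, rfl⟩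
  have hTi : IndepOn G {v, x, y} :=
    indepOn_insert (indepOn_pair hxy.2) (by simp [hvx.2, hvy.2])
  have hTm : IsMaxIndep G A {v, x, y} :=
    ⟨by simp [insert_subset_iff, hPA hv, hx, hy], hTi, by rw [hT3, ← hS3]; exact hS.card_le⟩
  have hdis : Disjoint ({s, b, c} : Finset V) {v, x, y} := by
    rw [disjoint_right]
    intro z hz
    simp only [mem_insert (b := x), mem_insert (b := v), mem_singleton] at hz
    rcases hz with rfl | rfl | rfl
    exacts [hvs.notMem hS.indep, hxb.notMem hS.indep, hyc.notMem hS.indep]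
  -- Deleting two triples costs two colours, so a vertex of `B` has at most three neighbours in
  -- their union and at least one in each. Two in the first triple would force four in total. So `B`
  -- is private, hence a clique, and its common owner extends it.
  obtain ⟨B, hB, hBc⟩ := exists_criticalOn (G := G) (B := (A \ {s, b, c}) \ {v, x, y}) (n := m - 1)
    fun hcol => h.critical.1 (((hcol.of_sdiff_indepOn hTi).of_sdiff_indepOn hS.indep).mono_right
      (by omega))
  have hBA : B ⊆ A := hB.trans (sdiff_subset.trans sdiff_subset)
  have hBS : ∀ z ∈ B, z ∉ ({s, b, c} : Finset V) := fun z hz =>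
    (mem_sdiff.1 (mem_sdiff.1 (hB hz)).1).2
  have hBT : ∀ z ∈ B, z ∉ ({v, x, y} : Finset V) := fun z hz => (mem_sdiff.1 (hB hz)).2
  have hcount : ∀ z ∈ B, (nbrIn G {s, b, c} z).card + (nbrIn G {v, x, y} z).card ≤ 3 := by
    intro z hz
    have h1 := h.card_nbrIn_le z (hBA hz)
    have h2 := hBc.le_card_nbrIn hz
    have hST : ({s, b, c} ∪ {v, x, y} : Finset V) ⊆ A \ B := by
      intro t ht
      rw [mem_sdiff]
      rcases mem_union.1 ht with ht | ht
      · exact ⟨hS.subset ht, fun htB => hBS t htB ht⟩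
      · exact ⟨hTm.subset ht, fun htB => hBT t htB ht⟩
    have h3 := card_le_card (nbrIn_mono (G := G) (v := z) hST)
    rw [card_nbrIn_union hdis] at h3
    rw [← card_nbrIn_add_card_nbrIn_sdiff hBA] at h1
    omega
  have hBp : ∀ z ∈ B, ∃ a, IsPrivate G {s, b, c} a z := by
    intro z hz
    have h1 := hcount z hz
    have h2 := card_pos.2 (hS.nbrIn_nonempty (hBA hz) (hBS z hz))
    have h3 := card_pos.2 (hTm.nbrIn_nonempty (hBA hz) (hBT z hz))
    refine card_eq_one.1 ?_
    by_contra hne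
    by_cases hzs : G.Adj z s
    · have hb : G.Adj z b → G.Adj z c := type z (hBA hz) b hbS c hcS hsb.symm hsc.symm hzs
      have hc : G.Adj z c → G.Adj z b := type z (hBA hz) c hcS b hbS hsc.symm hsb.symm hzs
      by_cases hzb : G.Adj z b
      · have : nbrIn G {s, b, c} z = {s, b, c} := filter_true_of_mem (by simp [hzs, hzb, hb hzb])
        rw [this, hS3] at h1
        omega
      · have : IsPrivate G {s, b, c} s z := IsPrivate.intro hsS hzs (by
          intro d hd hzd
          simp only [mem_insert, mem_singleton] at hd
          rcases hd with rfl | rfl | rfl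
          · rfl
          · exact (hzb hzd).elim
          · exact (hzb (hc hzd)).elim)
        exact hne (card_eq_one.2 ⟨s, this⟩)
    · have hzbc : G.Adj z b ∧ G.Adj z c := by
        have hsub : nbrIn G {s, b, c} z ⊆ {b, c} := by
          intro d hd
          rw [mem_nbrIn, mem_insert] at hd
          refine hd.1.resolve_left ?_
          rintro rfl
          exact hzs hd.2
        have heq := eq_of_subset_of_card_le hsub (card_le_two.trans (by omega))
        exact ⟨(mem_nbrIn.1 (heq.symm ▸ mem_insert_self b _ : b ∈ nbrIn G {s, b, c} z)).2,
          (mem_nbrIn.1 (heq.symm ▸ by simp : c ∈ nbrIn G {s, b, c} z)).2⟩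
      have hzx := hG.adj_of_isPrivate hS.indep hxb hcS hsS hbc.symm hsb hzbc.1 hzbc.2 hzs
      have hzy := hG.adj_of_isPrivate hS.indep hyc hbS hsS hbc hsc hzbc.2 hzbc.1 hzs
      have h4 : 1 < (nbrIn G {v, x, y} z).card := one_lt_card.2
        ⟨x, mem_nbrIn.2 ⟨by simp, hzx⟩, y, mem_nbrIn.2 ⟨by simp, hzy⟩, hxy.1⟩
      omega
  have hBcl := hS.isClique_of_isPrivate hG hS3.ge hBc hBA hBp
  obtain ⟨z, hz⟩ := hBc.nonempty
  obtain ⟨a, ha⟩ := hBp z hz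
  have hall : ∀ w ∈ B, G.Adj a w := by
    intro w hw
    obtain ⟨d, hd⟩ := hBp w hw
    by_cases hwz : w = z
    · rw [hwz]
      exact ha.adj.symm
    have had : a = d := by
      by_contra had
      exact (nadj ha hd had).2 (hBcl hz hw fun h => hwz h.symm)
    exact had ▸ hd.adj.symm
  refine hno (insert a B) (insert_subset (hS.subset ha.mem) hBA)
    (isClique_insert_of_adj hBcl hall) ?_
  rw [card_insert_of_notMem fun haB => hBS a haB ha.mem, hBc.card_eq_of_isClique hBcl]
  omega

/-- A clique of size `m` can be lifted from the peeled sets to a clique of size `m + 1`. -/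
lemma TightOn.exists_isClique_of_peel (h : TightOn G A (m + 1)) (hG : CoGemFree G) (hm : 6 ≤ m)
    (hS : IsMaxIndep G A S) (h3 : 3 ≤ S.card)
    (hyp : ∀ S B, Peel G A m S B → ¬ G.IsClique (B : Set V) →
      ∃ I ⊆ B, G.IsClique (I : Set V) ∧ I.card = m) :
    ∃ I ⊆ A, G.IsClique (I : Set V) ∧ I.card = m + 1 := by
  by_contra! hno
  have hncl : ∀ {S B : Finset V}, Peel G A m S B → ¬ G.IsClique (B : Set V) := fun {S B} p hB =>
    hno B p.subset_left hB (p.critical.card_eq_of_isClique hB)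
  obtain ⟨B, p⟩ := h.exists_peel hS h3
  obtain ⟨I, hIB, hI, hIm⟩ := hyp S B p (hncl p)
  set P := I.filter fun v => (nbrIn G S v).card < 2 with hPdef
  have hPI : P ⊆ I := filter_subset _ _
  -- The vertices of `I` outside `P` are low in `B`, so a smaller `P` contradicts
  -- `TightOn.not_isClique_of_low`.
  have hP3 : 3 ≤ P.card := by
    by_contra! hlt
    refine (p.tightOn (hncl p)).not_isClique_of_low hG hIB hI hIm hPI (by omega) ?_ (Or.inl hm)
    intro v hv hvP
    refine p.card_nbrIn_eq (hIB hv) ?_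
    by_contra! hlt
    exact hvP (mem_filter.2 ⟨hv, hlt⟩)
  have hIA := hIB.trans p.subset_left
  obtain ⟨v, hv⟩ := card_pos.1 (show 0 < P.card by omega)
  have hPp : ∀ q ∈ P, ∃ a, IsPrivate G S a q := fun q hq =>
    p.exists_isPrivate (hIB (hPI hq)) (mem_filter.1 hq).2
  obtain ⟨s, hvs⟩ := hPp v hv
  have hPs : ∀ q ∈ P, IsPrivate G S s q := by
    intro q hq
    obtain ⟨a, ha⟩ := hPp q hq
    by_cases hqv : q = v
    · exact hqv ▸ hvs
    have : a = s := by
      by_contra has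
      exact hG.not_adj_of_isPrivate hS.indep h3 ha hvs has (hI (hPI hq) (hPI hv) hqv)
    exact this ▸ ha
  have hsI : s ∉ I := fun hs => p.notMem (hIB hs) hvs.mem
  obtain ⟨w, hw, hws⟩ : ∃ w ∈ I, ¬ G.Adj s w := by
    by_contra! hall
    exact hno (insert s I) (insert_subset (hS.subset hvs.mem) hIA) (isClique_insert_of_adj hI hall)
      (by rw [card_insert_of_notMem hsI, hIm])
  have hwP : w ∉ P := fun hwP => hws (hPs w hwP).adj.symm
  have two : ∀ w ∈ I, w ∉ P → 2 ≤ (nbrIn G S w).card := by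
    intro w hw hwP
    by_contra! hlt
    exact hwP (mem_filter.2 ⟨hw, hlt⟩)
  obtain ⟨b, hb, c, hc, hbc⟩ := one_lt_card.1 (two w hw hwP)
  rw [mem_nbrIn] at hb hc
  have hsb : s ≠ b := by
    rintro rfl
    exact hws hb.2.symm
  have hsc : s ≠ c := by
    rintro rfl
    exact hws hc.2.symm
  have hvw : v ≠ w := fun h => hwP (h ▸ hv)
  -- A further `d` in `S` is either a third neighbour of `w`, over budget, or isolated from the
  -- induced path s v w b.
  have hSeq : S = {s, b, c} := by
    ext d
    simp only [mem_insert, mem_singleton]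
    constructor
    · intro hd
      by_contra! hne
      by_cases hdw : G.Adj d w
      · have h1 := p.bound (hIB hw)
        have h2 : ({b, c, d} : Finset V) ⊆ nbrIn G S w := by
          simp [insert_subset_iff, mem_nbrIn, hb, hc, hd, hdw.symm]
        have h3 := card_le_card h2
        rw [card_eq_three.2 ⟨b, c, d, hbc, hne.2.1.symm, hne.2.2.symm, rfl⟩] at h3
        omega
      · exact hG s v w b d hvs.adj.symm (hI (hPI hv) hw hvw) hb.2 hws
          (hS.indep s hvs.mem b hb.1) (hvs.not_adj hb.1 hsb.symm) (hS.indep d hd s hvs.mem)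
          (fun h => hvs.not_adj hd hne.1 h.symm) hdw (hS.indep d hd b hb.1)
    · rintro (rfl | rfl | rfl)
      exacts [hvs.mem, hb.1, hc.1]
  have hS3 : S.card = 3 := hSeq ▸ card_eq_three.2 ⟨s, b, c, hsb, hsc, hbc, rfl⟩
  have hvA : v ∈ A := hIA (hPI hv)
  have hvS : v ∉ S := hvs.notMem hS.indep
  have hvb : v ≠ b := fun h => hvS (h ▸ hb.1)
  have hvc : v ≠ c := fun h => hvS (h ▸ hc.1)
  have hR3 : ({v, b, c} : Finset V).card = 3 := card_eq_three.2 ⟨v, b, c, hvb, hvc, hbc, rfl⟩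
  have hR : IsMaxIndep G A {v, b, c} :=
    ⟨by simp [insert_subset_iff, hvA, hS.subset hb.1, hS.subset hc.1],
      indepOn_insert (indepOn_pair (hS.indep b hb.1 c hc.1))
        (by simp [hvs.not_adj hb.1 hsb.symm, hvs.not_adj hc.1 hsc.symm]),
      by rw [hR3, ← hS3]; exact hS.card_le⟩
  have hvR : v ∈ ({v, b, c} : Finset V) := by simp
  have hbR : b ∈ ({v, b, c} : Finset V) := by simp
  have hcR : c ∈ ({v, b, c} : Finset V) := by simp
  -- Exchange `s` for its private neighbour `v` and peel again. Now `w` sees the whole triple and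
  -- cannot lie in `D`, which also bars the rest of `I \ P`.
  obtain ⟨D, q⟩ := h.exists_peel hR hR3.ge
  have hIR : ∀ x ∈ I, x ≠ v → x ∉ ({v, b, c} : Finset V) := by
    intro x hx hxv hxR
    simp only [mem_insert, mem_singleton] at hxR
    rcases hxR with rfl | rfl | rfl
    exacts [hxv rfl, p.notMem (hIB hx) hb.1, p.notMem (hIB hx) hc.1]
  have hwD : w ∉ D := by
    intro hwD
    have h1 := q.bound hwD
    have h2 : nbrIn G {v, b, c} w = {v, b, c} :=
      filter_true_of_mem (by simp [hb.2, hc.2, hI hw (hPI hv) hvw.symm])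
    rw [h2, hR3] at h1
    omega
  have hWD : ∀ x ∈ I, x ∉ P → x ∉ D := by
    intro x hx hxP hxD
    have hxv : x ≠ v := fun h => hxP (h ▸ hv)
    have hxw : x ≠ w := fun h => hwD (h ▸ hxD)
    have h2 : 2 ≤ (nbrIn G {v, b, c} x).card := by
      obtain ⟨d, hd, hds⟩ := exists_mem_ne (two x hx hxP) s
      rw [mem_nbrIn] at hd
      have hdR : d ∈ ({v, b, c} : Finset V) := by
        have := hSeq ▸ hd.1
        simp only [mem_insert, mem_singleton] at this ⊢
        exact Or.inr (this.resolve_left hds)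
      refine one_lt_card.2 ⟨v, mem_nbrIn.2 ⟨hvR, hI hx (hPI hv) hxv⟩, d,
        mem_nbrIn.2 ⟨hdR, hd.2⟩, ?_⟩
      rintro rfl
      exact hvS hd.1
    exact hwD (q.mem_of_adj hxD h2 (hIA hw) (hI hx hw hxw) (hIR w hw hvw.symm))
  have hPv : ∀ x ∈ P, x ≠ v → IsPrivate G {v, b, c} v x := by
    intro x hx hxv
    refine IsPrivate.intro hvR (hI (hPI hx) (hPI hv) hxv) ?_
    intro d hd hxd
    simp only [mem_insert, mem_singleton] at hd
    rcases hd with rfl | rfl | rfl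
    · rfl
    · exact ((hPs x hx).not_adj hb.1 hsb.symm hxd).elim
    · exact ((hPs x hx).not_adj hc.1 hsc.symm hxd).elim
  -- A vertex `x` of `P` in `D` has all of `I \ P` outside the peel, so `P` has m - 1 vertices. If
  -- there is no such `x`, all of `D` is low and cannot contain the m-clique promised by `hyp`.
  by_cases hPD : ∃ x ∈ P, x ≠ v ∧ x ∈ D
  · obtain ⟨x, hx, hxv, hxD⟩ := hPD
    have hW1 : (I \ P).card ≤ 1 := by
      refine q.card_le_one hxD (sdiff_subset.trans hIA) ?_ ?_ ?_
      · rw [disjoint_left]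
        intro y hy
        rw [mem_sdiff] at hy
        exact hIR y hy.1 fun h => hy.2 (h ▸ hv)
      · rw [disjoint_left]
        intro y hy
        rw [mem_sdiff] at hy
        exact hWD y hy.1 hy.2
      · intro y hy
        rw [mem_sdiff] at hy
        exact hI (hPI hx) hy.1 fun h => hy.2 (h ▸ hx)
    have hW2 : 0 < (I \ P).card := card_pos.2 ⟨w, mem_sdiff.2 ⟨hw, hwP⟩⟩
    have hW3 := card_sdiff_add_card_eq_card hPI
    exact h.false_of_private_clique hG hno (hSeq ▸ hS) hsb hsc hbc (hPI.trans hIA)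
      (hI.subset (by exact_mod_cast hPI)) (by omega) (by omega) (fun x hx => hSeq ▸ hPs x hx)
  · push Not at hPD
    have hlow : ∀ z ∈ D, (nbrIn G D z).card = m := by
      intro z hz
      by_cases hz2 : 2 ≤ (nbrIn G {v, b, c} z).card
      · exact q.card_nbrIn_eq hz hz2
      obtain ⟨a, ha⟩ := q.exists_isPrivate hz (by omega)
      have hzA := q.subset_left hz
      have hav : a ≠ v := by
        rintro rfl
        have := q.card_le_one (T := P.erase a) hz ((erase_subset _ _).trans (hPI.trans hIA)) (by
            rw [disjoint_left]
            intro y hy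
            rw [mem_erase] at hy
            exact hIR y (hPI hy.2) hy.1) (by
            rw [disjoint_left]
            intro y hy
            rw [mem_erase] at hy
            exact hPD y hy.2 hy.1) (by
            intro y hy
            rw [mem_erase] at hy
            refine hR.adj_of_isPrivate hzA (hIA (hPI hy.2)) ha (hPv y hy.2 hy.1) ?_
            rintro rfl
            exact hPD z hy.2 hy.1 hz)
        rw [card_erase_of_mem hv] at this
        omega
      have hzv : ¬ G.Adj z v := ha.not_adj hvR hav.symm
      -- `z` is private to `b` for the old `S` too, so `w` sees it; lying outside the peel, `w` uses
      -- up the spare neighbour of `z`.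
      have key : ∀ b c, S = {s, b, c} → s ≠ b → s ≠ c → b ≠ c → G.Adj w b → G.Adj w c →
          G.Adj z b → ¬ G.Adj z c → G.Adj w z := by
        intro b c hSeq hsb hsc hbc hwb hwc hzb hzc
        have hbS : b ∈ S := by simp [hSeq]
        have hcS : c ∈ S := by simp [hSeq]
        have hzs : ¬ G.Adj z s := fun hzs =>
          hzv (hG.adj_of_isPrivate hS.indep hvs hbS hcS hsb.symm hsc.symm hzs hzb hzc)
        refine hG.adj_of_isPrivate hS.indep (IsPrivate.intro hbS hzb ?_) hcS hvs.mem hbc.symm hsb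
          hwb hwc fun h => hws h.symm
        intro d hd hzd
        rw [hSeq, mem_insert, mem_insert, mem_singleton] at hd
        rcases hd with rfl | rfl | rfl
        exacts [(hzs hzd).elim, rfl, (hzc hzd).elim]
      have hwz : G.Adj w z := by
        have haR := ha.mem
        rw [mem_insert, mem_insert, mem_singleton] at haR
        rcases haR with rfl | rfl | rfl
        · exact (hav rfl).elim
        · exact key _ c hSeq hsb hsc hbc hb.2 hc.2 ha.adj (ha.not_adj hcR hbc.symm)
        · exact key _ b (by rw [hSeq, pair_comm]) hsc hsb hbc.symm hc.2 hb.2 ha.adj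
            (ha.not_adj hbR hbc)
      exact q.card_nbrIn_eq_of_adj hz (hIA hw) hwz.symm (hIR w hw hvw.symm) hwD
    obtain ⟨J, hJD, hJ, hJm⟩ := hyp _ D q (hncl q)
    exact (q.tightOn (hncl q)).not_isClique_of_low hG hJD hJ hJm (empty_subset J) (by simp)
      (fun z hz _ => hlow z (hJD hz)) (Or.inl hm)

/-- A second layer is not yet contradictory, so the clique found in the peel has to be lifted. -/
lemma Layered.exists_isClique_of_one {W : ℕ → Finset V} (hW : Layered G A m 1 W)
    (h : TightOn G A m) (hG : CoGemFree G) (hm : 7 ≤ m) :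
    ∃ I ⊆ A, G.IsClique (I : Set V) ∧ I.card = m := by
  obtain ⟨S, hS⟩ := exists_isMaxIndep G A
  by_cases h3 : 3 ≤ S.card
  · obtain ⟨m, rfl⟩ : ∃ k, m = k + 1 := ⟨m - 1, by omega⟩
    refine h.exists_isClique_of_peel hG (by omega) hS h3 fun S B p hB => ?_
    obtain ⟨W', hW'⟩ := p.layered hG hW
    exact hW'.exists_isClique_of_two (p.tightOn hB) hG (by omega)
  · obtain ⟨x, hx, hlow⟩ := hW.exists_low h (by omega)
    exact h.exists_isClique_of_card_le_two
      (fun T hT hTi => (hS.card_le T hT hTi).trans (by omega)) hx hlow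

/-- A tight set has independence number at most two if `m ≥ 8`. -/
lemma TightOn.card_le_two (h : TightOn G A m) (hG : CoGemFree G) (hm : 8 ≤ m)
    (hS : IsMaxIndep G A S) : S.card ≤ 2 := by
  by_contra! h3
  obtain ⟨m, rfl⟩ : ∃ k, m = k + 1 := ⟨m - 1, by omega⟩
  obtain ⟨I, hIA, hI, hIm⟩ := h.exists_isClique_of_peel hG (by omega) hS h3 fun S B p hB => by
    obtain ⟨W', hW'⟩ := p.layered hG (i := 0) (W := fun _ => ∅)
      ⟨by simp, by simp, by simp⟩
    exact hW'.exists_isClique_of_one (p.tightOn hB) hG (by omega)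
  exact h.card_ne_of_isClique hG hm hIA hI hIm

end Peeling

/-! ### Independence number two and the final contradiction. -/

section Conclusion

variable {V : Type u} {G : SimpleGraph V} {A : Finset V} {m : ℕ}

/-- A tight set with `m ≥ 8` has three pairwise non-adjacent vertices. -/
lemma TightOn.exists_indepOn_three (h : TightOn G A m) (hm : 8 ≤ m) :
    ∃ T ⊆ A, IndepOn G T ∧ 3 ≤ T.card := by
  by_contra! hα
  let K : SimpleGraph A := (G.comap Subtype.val)ᶜ
  have hK : ∀ x y : A, K.Adj x y ↔ x ≠ y ∧ ¬ G.Adj x y := fun x y => by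
    simp [K, SimpleGraph.compl_adj]
  have hn := h.two_mul_lt_card
  obtain ⟨a, ha⟩ := h.critical.nonempty
  have : Nonempty A := ⟨⟨a, ha⟩⟩
  have hfree : K.CliqueFree 3 := by
    intro s hs
    refine absurd (hα (s.map (Function.Embedding.subtype _)) ?_ ?_) ?_
    · intro x hx
      obtain ⟨y, -, rfl⟩ := mem_map.1 hx
      exact y.2
    · intro x hx y hy hxy
      obtain ⟨x, hx', rfl⟩ := mem_map.1 hx
      obtain ⟨y, hy', rfl⟩ := mem_map.1 hy
      have hne : x ≠ y := fun h => G.loopless.irrefl _ (h ▸ hxy)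
      exact ((hK x y).1 (hs.isClique hx' hy' hne)).2 hxy
    · rw [card_map, hs.card_eq]
      omega
  have hdeg : A.card - m - 2 ≤ K.minDegree := by
    refine SimpleGraph.le_minDegree_of_forall_le_degree _ _ fun v => ?_
    have h1 : A \ insert (v : V) (nbrIn G A v) ⊆
        (K.neighborFinset v).map (Function.Embedding.subtype _) := by
      intro x hx
      rw [mem_sdiff, mem_insert, mem_nbrIn, not_or, not_and] at hx
      refine mem_map.2 ⟨⟨x, hx.1⟩, ?_, rfl⟩
      rw [SimpleGraph.mem_neighborFinset, hK]
      exact ⟨fun h => hx.2.1 (congrArg Subtype.val h).symm, hx.2.2 hx.1⟩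
    have h2 := card_le_card h1
    rw [card_map, SimpleGraph.card_neighborFinset_eq_degree] at h2
    have h3 := h.card_nbrIn_le v v.2
    have h4 := card_insert_le (v : V) (nbrIn G A v)
    have h5 := le_card_sdiff (insert (v : V) (nbrIn G A v)) A
    omega
  -- Andrásfai's theorem needs minimum degree above 2n/5. With n ≥ 2m + 1, the bound n - m - 2
  -- exceeds this once m ≥ 8.
  obtain ⟨col⟩ : K.Colorable 2 := SimpleGraph.colorable_of_cliqueFree_lt_minDegree hfree (by
    rw [Fintype.card_coe]
    omega)
  obtain ⟨i, -, hi⟩ := exists_lt_card_fiber_of_mul_lt_card_of_maps_to (s := univ)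
    (t := (univ : Finset (Fin 2))) (f := fun x : A => col x) (n := m) (fun _ _ => mem_univ _) (by
      rw [card_univ, card_univ, Fintype.card_coe, Fintype.card_fin]
      omega)
  have := h.card_le ((univ.filter fun x : A => col x = i).map (Function.Embedding.subtype _)) (by
      intro x hx
      obtain ⟨y, -, rfl⟩ := mem_map.1 hx
      exact y.2) (by
      intro x hx y hy hxy
      rw [mem_coe] at hx hy
      obtain ⟨x, hx', rfl⟩ := mem_map.1 hx
      obtain ⟨y, hy', rfl⟩ := mem_map.1 hy
      rw [mem_filter] at hx' hy'
      by_contra hadj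
      exact col.valid ((hK x y).2 ⟨fun h => hxy (congrArg _ h), hadj⟩) (hx'.2.trans hy'.2.symm))
  rw [card_map] at this
  omega

/-- There are no tight sets for `m ≥ 8`. -/
theorem CoGemFree.not_tightOn (hG : CoGemFree G) (hm : 8 ≤ m) : ¬ TightOn G A m := by
  intro h
  obtain ⟨S, hS⟩ := exists_isMaxIndep G A
  obtain ⟨T, hTA, hT, h3⟩ := h.exists_indepOn_three hm
  have := h.card_le_two hG hm hS
  have := hS.card_le T hTA hT
  omega

/-- The maximum is what makes a critical set tight: Δ - 1 supplies the degree bound and ω the clique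
bound. -/
theorem CoGemFree.colorable [Fintype V] [DecidableRel G.Adj] (hG : CoGemFree G)
    (hΔ : 9 ≤ G.maxDegree) : G.Colorable (max (G.maxDegree - 1) G.cliqueNum) := by
  set m := max (G.maxDegree - 1) G.cliqueNum with hm
  have hm1 : G.maxDegree - 1 ≤ m := le_max_left _ _
  have hm2 : G.cliqueNum ≤ m := le_max_right _ _
  by_contra hcol
  obtain ⟨A, -, hA⟩ := exists_criticalOn (G := G) (B := univ) (n := m) fun h => by
    obtain ⟨f, hf, hlt⟩ := h.exists_lt
    exact hcol ⟨SimpleGraph.Coloring.mk (fun v => (⟨f v, hlt v (mem_univ v)⟩ : Fin m))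
      fun {u v} huv heq => hf u (mem_univ u) v (mem_univ v) huv (Fin.mk.inj_iff.1 heq)⟩
  refine hG.not_tightOn (by omega) (m := m) (A := A) ⟨hA, fun v _ => ?_, fun T _ hT => ?_⟩
  · have h1 : (nbrIn G A v).card ≤ G.degree v := by
      rw [← SimpleGraph.card_neighborFinset_eq_degree]
      exact card_le_card fun x hx => by
        rw [SimpleGraph.mem_neighborFinset]
        exact (mem_nbrIn.1 hx).2
    have h2 := G.degree_le_maxDegree v
    omega
  · exact (SimpleGraph.IsClique.card_le_cliqueNum (tc := hT)).trans hm2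

lemma isIndContained_of_forall_adj_iff {W : Type*} {H : SimpleGraph W} (f : W → V)
    (hf : Function.Injective f) (h : ∀ x y, G.Adj (f x) (f y) ↔ H.Adj x y) :
    H.IsIndContained G :=
  ⟨⟨⟨f, hf⟩, h _ _⟩⟩

lemma IsInducedFree.coGemFree (h : IsInducedFree graphP4K1 G) : CoGemFree G := by
  intro a b c d e hab hbc hcd hac had hbd hea heb hec hed
  have hne : ∀ {x y z : V}, G.Adj x y → ¬ G.Adj z y → x ≠ z := fun hxy hzy h => hzy (h ▸ hxy)
  refine h (isIndContained_of_forall_adj_iff (Sum.elim ![a, b, c, d] ![e]) ?_ ?_)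
  · have h1 : a ≠ b := hab.ne
    have h2 : b ≠ c := hbc.ne
    have h3 : c ≠ d := hcd.ne
    have h4 : a ≠ c := (hne hcd had).symm
    have h5 : a ≠ d := hne hab fun h => hbd h.symm
    have h6 : b ≠ d := hne hab.symm fun h => had h.symm
    have h7 : a ≠ e := hne hab heb
    have h8 : b ≠ e := hne hbc hec
    have h9 : c ≠ e := hne hcd hed
    have h10 : d ≠ e := hne hcd.symm hec
    rintro (x | x) (y | y) hxy <;> fin_cases x <;> fin_cases y <;> simp_all
  · have hac' := mt G.adj_symm hac
    have had' := mt G.adj_symm had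
    have hbd' := mt G.adj_symm hbd
    have hea' := mt G.adj_symm hea
    have heb' := mt G.adj_symm heb
    have hec' := mt G.adj_symm hec
    have hed' := mt G.adj_symm hed
    have hba := hab.symm
    have hcb := hbc.symm
    have hdc := hcd.symm
    rintro (x | x) (y | y) <;> fin_cases x <;> fin_cases y <;>
      simp [graphP4K1, SimpleGraph.pathGraph_adj, *]

lemma isIndContained_graphP3K1 : graphP3K1.IsIndContained graphP4K1 := by
  refine isIndContained_of_forall_adj_iff (Sum.elim (fun i => Sum.inl i.castSucc) Sum.inr) ?_ ?_
  · rintro (x | x) (y | y) hxy <;> simp_all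
  · rintro (x | x) (y | y) <;> simp [graphP3K1, graphP4K1, SimpleGraph.pathGraph_adj]

lemma isIndContained_graphK2TwoK1 : graphK2TwoK1.IsIndContained graphP4K1 := by
  refine isIndContained_of_forall_adj_iff
    (Sum.elim ![Sum.inl 0, Sum.inl 1] ![Sum.inl 3, Sum.inr 0]) ?_ ?_
  · rintro (x | x) (y | y) hxy <;> fin_cases x <;> fin_cases y <;> simp_all
  · rintro (x | x) (y | y) <;> fin_cases x <;> fin_cases y <;>
      simp [graphK2TwoK1, graphP4K1, SimpleGraph.pathGraph_adj]

lemma isIndContained_graphThreeK1 : graphThreeK1.IsIndContained graphP4K1 := by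
  refine isIndContained_of_forall_adj_iff ![Sum.inl 0, Sum.inl 2, Sum.inr 0] ?_ ?_
  · intro x y hxy
    fin_cases x <;> fin_cases y <;> simp_all
  · intro x y
    fin_cases x <;> fin_cases y <;>
      simp [graphThreeK1, graphP4K1, SimpleGraph.pathGraph_adj]

end Conclusion

end Development

theorem mainTheorem3 {V : Type*} [Fintype V] (G : SimpleGraph V) [DecidableRel G.Adj]
    (hΔ : 9 ≤ G.maxDegree) :
    (IsInducedFree graphP4K1 G →
      G.chromaticNumber ≤ ((max (G.maxDegree - 1) G.cliqueNum : ℕ) : ℕ∞)) ∧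
    (IsInducedFree graphP3K1 G →
      G.chromaticNumber ≤ ((max (G.maxDegree - 1) G.cliqueNum : ℕ) : ℕ∞)) ∧
    (IsInducedFree graphK2TwoK1 G →
      G.chromaticNumber ≤ ((max (G.maxDegree - 1) G.cliqueNum : ℕ) : ℕ∞)) ∧
    (IsInducedFree graphThreeK1 G →
      G.chromaticNumber ≤ ((max (G.maxDegree - 1) G.cliqueNum : ℕ) : ℕ∞)) := by
  have main : IsInducedFree graphP4K1 G →
      G.chromaticNumber ≤ ((max (G.maxDegree - 1) G.cliqueNum : ℕ) : ℕ∞) := fun h =>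
    (h.coGemFree.colorable hΔ).chromaticNumber_le
  exact ⟨main, fun h => main fun h' => h (isIndContained_graphP3K1.trans h'),
    fun h => main fun h' => h (isIndContained_graphK2TwoK1.trans h'),
    fun h => main fun h' => h (isIndContained_graphThreeK1.trans h')⟩
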